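/- Let $H$ be a separable real Hilbert space, let $X$ be an $H$-valued random variable, and let $m$ be a geometric median of $X$, i.e. a minimizer over $h\in H$ of $G(h)=\mathbb{E}[\|X-h\|-\|X\|]$. Assume: (A1) for every $h\in H$ there is $h'\in H$ with $\langle h,h'\rangle=0$ and $\mathrm{Var}(\langle h',X\rangle)>0$ (the variance being $+\infty$ when $\langle h',X\rangle$ is not square integrable); (A2) there is $C>0$ such that $\mathbb{E}[\|X-h\|^{-1}]\le C$ for all $h\in H$; (A3) there is $C>0$ such that $\mathbb{E}[\|X-h\|^{-2}]\le C$ for all $h\in H$ (with $1/0=\infty$). Let $X_1,X_2,\dots$ be i.i.d. copies of $X$, let $\gamma_n=c_\gamma n^{-\alpha}$ with $c_\gamma>0$ and $\alpha\in(1/2,1)$, let $Z_1$ be an almost surely bounded $H$-valued random variable that is independent of $(X_2,X_3,\dots)$, and put, for $n\ge 1$, $$Z_{n+1}=Z_n+\gamma_n\frac{X_{n+1}-Z_n}{\|X_{n+1}-Z_n\|},\qquad \overline Z_n=\frac1n\sum_{i=1}^n Z_i .$$ Let $$\Gamma_m=\mathbb{E}\left[\frac{1}{\|X-m\|}\left(I_H-\frac{(X-m)\otimes(X-m)}{\|X-m\|^2}\right)\right],\qquad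 (u\otimes u)(h)=\langle u,h\rangle u .$$ Then $\Gamma_m$ is the Hessian of $G$ at $m$ (the Fréchet derivative of $\nabla G$ at $m$), it has a smallest eigenvalue $\lambda_{\min}$, and $\lambda_{\min}>0$. Moreover, for every $\delta\in(0,1)$ there is a rank $n_\delta$ such that for all $n\ge n_\delta$, $$\mathbb{P}\left[\|\Gamma_m(\overline Z_n-m)\|\le 4\left(\frac{2}{3n}+\frac1{\sqrt n}\right)\ln\frac4\delta\right]\ge 1-\delta$$ and $$\mathbb{P}\left[\|\overline Z_n-m\|\le \frac{4}{\lambda_{\min}}\left(\frac{2}{3n}+\frac1{\sqrt n}\right)\ln\frac4\delta\right]\ge 1-\delta .$$ -/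

import Mathlib

open MeasureTheory ProbabilityTheory
open scoped RealInnerProductSpace

noncomputable section

/-- The criterion `G(h) = 𝔼[‖X - h‖ - ‖X‖]` minimised by the geometric median. The integrand is
bounded by `‖h‖`, so that no moment of `X` is needed. -/
def medianObjective {Ω H : Type*} [MeasurableSpace Ω] [NormedAddCommGroup H]
    (P : Measure Ω) (X : Ω → H) (h : H) : ℝ :=
  ∫ ω, (‖X ω - h‖ - ‖X ω‖) ∂P

/-- `m` is a geometric median of `X`: a minimiser over the whole space of
`h ↦ 𝔼[‖X - h‖ - ‖X‖]`. -/
def IsGeometricMedian {Ω H : Type*} [MeasurableSpace Ω] [NormedAddCommGroup H]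
    (P : Measure Ω) (X : Ω → H) (m : H) : Prop :=
  ∀ h : H, medianObjective P X m ≤ medianObjective P X h

/-- The operator `Γ_h = 𝔼[‖X - h‖⁻¹ (I - (X - h) ⊗ (X - h) / ‖X - h‖²)]`, a Bochner integral in
the space of bounded operators, where `(u ⊗ u) v = ⟪u, v⟫ u`. -/
def medianHessian {Ω H : Type*} [MeasurableSpace Ω] [NormedAddCommGroup H]
    [InnerProductSpace ℝ H] (P : Measure Ω) (X : Ω → H) (h : H) : H →L[ℝ] H :=
  ∫ ω, ‖X ω - h‖⁻¹ • (ContinuousLinearMap.id ℝ H -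
    (‖X ω - h‖ ^ 2)⁻¹ • InnerProductSpace.rankOne ℝ (X ω - h) (X ω - h)) ∂P

/-- `X` is not concentrated on a straight line. The extended variance is used, since `X` need not
have any moment: it vanishes only for almost surely constant variables, and it is `∞` for
variables that are not square integrable. -/
def NotConcentratedOnLine {Ω H : Type*} [MeasurableSpace Ω] [NormedAddCommGroup H]
    [InnerProductSpace ℝ H] (P : Measure Ω) (X : Ω → H) : Prop :=
  ∀ h : H, ∃ h' : H, ⟪h, h'⟫ = 0 ∧ 0 < evariance (fun ω => ⟪h', X ω⟫) P

/-- The inverse moment `𝔼[‖X - h‖⁻ᵖ]` is bounded uniformly in `h`, with `1 / 0 = ∞`. -/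
def BoundedInverseMoment {Ω H : Type*} [MeasurableSpace Ω] [NormedAddCommGroup H]
    (P : Measure Ω) (X : Ω → H) (p : ℕ) : Prop :=
  ∃ C : ℝ, 0 < C ∧ ∀ h : H, ∫⁻ ω, (‖X ω - h‖ₑ ^ p)⁻¹ ∂P ≤ ENNReal.ofReal C

/-- The step sizes `γ_n = c n^{-α}`. -/
def stepSize (c α : ℝ) (n : ℕ) : ℝ := c * (n : ℝ) ^ (-α)

/-- The stochastic gradient algorithm `Z_{n+1} = Z_n + γ_n (X_{n+1} - Z_n) / ‖X_{n+1} - Z_n‖` for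
`n ≥ 1`, started at `Z_1`. The entry at `n = 0` and the value `X_0` play no role. -/
def medianSGD {Ω H : Type*} [NormedAddCommGroup H] [InnerProductSpace ℝ H]
    (γ : ℕ → ℝ) (X : ℕ → Ω → H) (Z₁ : Ω → H) : ℕ → Ω → H
  | 0 => fun _ => 0
  | 1 => Z₁
  | n + 2 => fun ω =>
      medianSGD γ X Z₁ (n + 1) ω + γ (n + 1) •
        (‖X (n + 2) ω - medianSGD γ X Z₁ (n + 1) ω‖⁻¹ •
          (X (n + 2) ω - medianSGD γ X Z₁ (n + 1) ω))

/-- The averaged algorithm, `(Z_1 + ⋯ + Z_n) / n`. -/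
def averagedSGD {Ω H : Type*} [NormedAddCommGroup H] [InnerProductSpace ℝ H]
    (γ : ℕ → ℝ) (X : ℕ → Ω → H) (Z₁ : Ω → H) (n : ℕ) (ω : Ω) : H :=
  (n : ℝ)⁻¹ • ∑ k ∈ Finset.Icc 1 n, medianSGD γ X Z₁ k ω

end

/-! The gradient of the criterion is `-𝔼[dir (X - h)]`, where `dir y = y / ‖y‖`. The algorithm is
therefore a stochastic gradient descent with unit-size increments. Write Γ for the Hessian at `m`, Φ
for the gradient, and shift indices so that the iterates start at `z 0`. Since Φ vanishes at `m`,
one step rearranges into the exact identity Γ(z_k - m) = (z_k - z_{k+1}) / γ_k + dir(x_k - m) +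
noiseDiff_k - (Φ(z_k) - Γ(z_k - m)).

Summed over k < n, the second term is a sum of independent centred unit vectors. It is sub-Gaussian
without any dimension factor, because `𝔼 cosh(l ‖S_n‖) ≤ (cosh l)^n` (`integral_cosh_norm_sum_le`).
The other terms have mean O(n^{α/2} + n^{1-α}), which is o(√n) exactly because 1/2 < α < 1
(`exists_integral_remainder_le`): summation by parts handles the first one, orthogonality of
martingale increments the third, and the second-order Taylor bound the last.

These means rest on the rate `𝔼‖z_k - m‖² = O(k^{-α})`. It needs strong monotonicity of Φ, which is
available only on balls, so everything is truncated to the event of having stayed in a ball of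
radius A. As ∑ γ_k² < ∞, that event has probability at least 1 - δ/4 for a suitable A
(`sq_mul_integral_exit_le`).

For the spectrum, Γ = 𝔼[w] I - K with K = 𝔼[w u ⊗ u] positive and compact. Hence ‖K‖ is an
eigenvalue of K, and 𝔼[w] - ‖K‖ is the least eigenvalue of Γ. Were it zero, X would lie on a line
through `m`. The same argument with a bounded weight gives the strong monotonicity
(`exists_hasEigenvalue_weightedOperator`). -/

set_option linter.unusedSectionVars false

/-! ### Inequalities for the direction map `y ↦ y / ‖y‖`. -/

section Geometry

variable {H : Type*} [NormedAddCommGroup H] [InnerProductSpace ℝ H]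

/-- The unit vector pointing in the direction of `y`, with `dir 0 = 0`. -/
noncomputable def dir (y : H) : H := ‖y‖⁻¹ • y

lemma norm_dir {y : H} (hy : y ≠ 0) : ‖dir y‖ = 1 := by
  rw [dir, norm_smul, norm_inv, norm_norm, inv_mul_cancel₀ (norm_ne_zero_iff.2 hy)]

lemma norm_dir_le_one (y : H) : ‖dir y‖ ≤ 1 := by
  by_cases hy : y = 0
  · simp [dir, hy]
  · exact (norm_dir hy).le

lemma norm_smul_dir (y : H) : ‖y‖ • dir y = y := by
  by_cases hy : y = 0
  · simp [hy]
  · rw [dir, smul_inv_smul₀ (norm_ne_zero_iff.2 hy)]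

lemma inner_dir_self (y : H) : ⟪dir y, y⟫ = ‖y‖ := by
  by_cases hy : y = 0
  · simp [hy]
  · have := norm_ne_zero_iff.2 hy
    rw [dir, real_inner_smul_left, real_inner_self_eq_norm_sq]
    field_simp

lemma inner_dir_le (a b : H) : ⟪dir a, b⟫ ≤ ‖b‖ :=
  (real_inner_le_norm _ _).trans
    (mul_le_of_le_one_left (norm_nonneg _) (norm_dir_le_one a))

lemma norm_dir_sub_dir_le_two (a b : H) : ‖dir a - dir b‖ ≤ 2 := by
  linarith [norm_sub_le (dir a) (dir b), norm_dir_le_one a, norm_dir_le_one b]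

/-- Multiplying by `‖a‖` removes the singular denominator. The first and second order bounds both
start from this identity. -/
lemma norm_smul_dir_sub_dir (a b : H) :
    ‖a‖ • (dir a - dir b) = (a - b) + (‖b‖ - ‖a‖) • dir b := by
  rw [smul_sub, sub_smul, norm_smul_dir, norm_smul_dir]
  abel

lemma norm_mul_norm_dir_sub_dir_le (a b : H) : ‖a‖ * ‖dir a - dir b‖ ≤ 2 * ‖a - b‖ := by
  have h : ‖‖a‖ • (dir a - dir b)‖ ≤ ‖a - b‖ + ‖a - b‖ * 1 := by
    rw [norm_smul_dir_sub_dir]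
    refine (norm_add_le _ _).trans ?_
    rw [norm_smul]
    have h1 : ‖‖b‖ - ‖a‖‖ ≤ ‖a - b‖ := by
      rw [Real.norm_eq_abs, norm_sub_rev]; exact abs_norm_sub_norm_le b a
    gcongr
    exact norm_dir_le_one b
  rw [norm_smul, norm_norm] at h
  linarith

/-- Only `‖a‖` is inverted: with `a = X - m` and `b = X - h`, an inverse moment at `m` alone
controls every `h`. -/
lemma norm_dir_sub_dir_le {a : H} (ha : a ≠ 0) (b : H) :
    ‖dir a - dir b‖ ≤ 2 * ‖a - b‖ * ‖a‖⁻¹ := by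
  rw [← div_eq_mul_inv, le_div_iff₀ (norm_pos_iff.2 ha), mul_comm]
  exact norm_mul_norm_dir_sub_dir_le a b

lemma inner_dir_sub_dir_nonneg (a b : H) : 0 ≤ ⟪dir a - dir b, a - b⟫ := by
  have h1 := inner_dir_le a b
  have h2 := inner_dir_le b a
  simp only [inner_sub_left, inner_sub_right, inner_dir_self]
  linarith

/-- The inner product `⟪dir a - dir b, a - b⟫` is the sum of the nonnegative terms `‖a‖ - ⟪dir b,
a⟫` and `‖b‖ - ⟪dir a, b⟫`. Each is thus bounded by the sum, to which Cauchy–Schwarz applies. -/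
lemma norm_sub_inner_dir_le (a b : H) : ‖b‖ - ⟪dir a, b⟫ ≤ ‖dir a - dir b‖ * ‖a - b‖ := by
  have h2 : ⟪dir a - dir b, a - b⟫ ≤ ‖dir a - dir b‖ * ‖a - b‖ := real_inner_le_norm _ _
  have h3 := inner_dir_le b a
  simp only [inner_sub_left, inner_sub_right, inner_dir_self] at h2
  linarith

/-- The second order Taylor bound for the direction map. -/
lemma norm_dir_sub_dir_sub_le {a : H} (ha : a ≠ 0) (b : H) :
    ‖dir a - dir b - ‖a‖⁻¹ • ((a - b) - ⟪dir a, a - b⟫ • dir a)‖ ≤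
      4 * ‖a - b‖ ^ 2 * (‖a‖ ^ 2)⁻¹ := by
  have ha' : 0 < ‖a‖ := norm_pos_iff.2 ha
  have hb := norm_dir_sub_dir_le ha b
  set D := ‖dir a - dir b‖ with hD
  set t := ‖a - b‖ with ht
  -- An exact formula for the Taylor error: each summand has norm at most `D * t`, and `D` is itself
  -- of order `t / ‖a‖`.
  have key : ‖a‖ • (dir a - dir b - ‖a‖⁻¹ • ((a - b) - ⟪dir a, a - b⟫ • dir a)) =
      (‖b‖ - ⟪dir a, b⟫) • dir b + ⟪dir a, a - b⟫ • (dir a - dir b) := by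
    rw [smul_sub, norm_smul_dir_sub_dir, smul_inv_smul₀ ha'.ne', inner_sub_right, inner_dir_self]
    module
  have h1 : ‖b‖ - ⟪dir a, b⟫ ≤ D * t := norm_sub_inner_dir_le a b
  have h2 : 0 ≤ ‖b‖ - ⟪dir a, b⟫ := by linarith [inner_dir_le a b]
  have h3 : |⟪dir a, a - b⟫| ≤ t := by
    refine (abs_real_inner_le_norm _ _).trans ?_
    exact mul_le_of_le_one_left (norm_nonneg _) (norm_dir_le_one a)
  have h4 : ‖a‖ * ‖dir a - dir b - ‖a‖⁻¹ • ((a - b) - ⟪dir a, a - b⟫ • dir a)‖ ≤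
      2 * (D * t) := by
    rw [← norm_norm a, ← norm_smul, norm_norm, key]
    refine (norm_add_le _ _).trans ?_
    rw [norm_smul, norm_smul, Real.norm_eq_abs, Real.norm_eq_abs, abs_of_nonneg h2]
    have h5 := mul_le_mul h1 (norm_dir_le_one b) (norm_nonneg _) (h2.trans h1)
    have h6 := mul_le_mul_of_nonneg_right h3 (norm_nonneg (dir a - dir b))
    rw [← hD] at h6 ⊢
    linarith
  have h5 : D * t ≤ 2 * t ^ 2 * ‖a‖⁻¹ := by
    have := mul_le_mul_of_nonneg_right hb (norm_nonneg (a - b))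
    rw [← ht] at this
    linarith
  rw [← mul_le_mul_iff_right₀ ha']
  refine h4.trans ?_
  have : ‖a‖ * (4 * t ^ 2 * (‖a‖ ^ 2)⁻¹) = 4 * t ^ 2 * ‖a‖⁻¹ := by field_simp
  rw [this]; linarith

/-- Quantitative monotonicity of the direction map. -/
lemma inner_dir_sub_dir_ge {a : H} (ha : a ≠ 0) (b : H) :
    (‖a‖ + ‖a - b‖)⁻¹ * (‖a - b‖ ^ 2 - ⟪dir a, a - b⟫ ^ 2) ≤
      2 * ⟪dir a - dir b, a - b⟫ := by
  have ha' : 0 < ‖a‖ := norm_pos_iff.2 ha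
  by_cases hb : b = 0
  · subst hb
    simp only [sub_zero, inner_dir_self, sub_self, mul_zero]
    linarith [inner_dir_sub_dir_nonneg a 0, sub_zero a ▸ inner_dir_sub_dir_nonneg a 0]
  have hb' : 0 < ‖b‖ := norm_pos_iff.2 hb
  -- In terms of the cosine `c`, the quadratic form is `‖b‖² (1 - c²)` and the inner product is
  -- `(‖a‖ + ‖b‖) (1 - c)`; the factor 2 bounds `1 + c`.
  set c := ⟪dir a, dir b⟫ with hc
  have hab : ⟪dir a, b⟫ = ‖b‖ * c := by
    conv_lhs => rw [← norm_smul_dir b]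
    rw [real_inner_smul_right]
  have hba : ⟪dir b, a⟫ = ‖a‖ * c := by
    conv_lhs => rw [← norm_smul_dir a]
    rw [real_inner_smul_right, real_inner_comm]
  have hin : ⟪a, b⟫ = ‖a‖ * ‖b‖ * c := by
    conv_lhs => rw [← norm_smul_dir a]
    rw [real_inner_smul_left, hab, mul_assoc]
  have hc1 : |c| ≤ 1 := by
    have := abs_real_inner_le_norm (dir a) (dir b)
    rwa [norm_dir ha, norm_dir hb, mul_one] at this
  have h1 : ‖a - b‖ ^ 2 - ⟪dir a, a - b⟫ ^ 2 = ‖b‖ ^ 2 * (1 - c ^ 2) := by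
    rw [norm_sub_sq_real, inner_sub_right, inner_dir_self, hin, hab]; ring
  have h2 : ⟪dir a - dir b, a - b⟫ = (‖a‖ + ‖b‖) * (1 - c) := by
    simp only [inner_sub_left, inner_sub_right, inner_dir_self, hab, hba]; ring
  have h3 : ‖b‖ ≤ ‖a‖ + ‖a - b‖ := by
    have := norm_sub_norm_le b a
    rw [norm_sub_rev] at this; linarith
  rw [h1, h2, inv_mul_le_iff₀ (by positivity)]
  obtain ⟨hc2, hc3⟩ := abs_le.1 hc1
  have h4 : ‖b‖ ^ 2 ≤ (‖a‖ + ‖a - b‖) * (‖a‖ + ‖b‖) := by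
    nlinarith [norm_nonneg (a - b)]
  calc ‖b‖ ^ 2 * (1 - c ^ 2) = ‖b‖ ^ 2 * (1 + c) * (1 - c) := by ring
    _ ≤ ((‖a‖ + ‖a - b‖) * (‖a‖ + ‖b‖)) * 2 * (1 - c) := by
        gcongr
        · linarith
        · linarith
    _ = _ := by ring

/-- The function `t ↦ cosh (l √t)` is convex on `t ≥ 0`, since its power series has nonnegative
coefficients. The comparison is made term by term. -/
lemma convex_comb_cosh_sqrt {l s p q : ℝ} (hs : |s| ≤ 1) {r : ℝ}
    (hr : r ^ 2 = (1 + s) / 2 * p ^ 2 + (1 - s) / 2 * q ^ 2) :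
    Real.cosh (l * r) ≤ (1 + s) / 2 * Real.cosh (l * p) + (1 - s) / 2 * Real.cosh (l * q) := by
  obtain ⟨hs1, hs2⟩ := abs_le.1 hs
  refine hasSum_le (fun n => ?_) (Real.hasSum_cosh (l * r))
    (((Real.hasSum_cosh (l * p)).mul_left ((1 + s) / 2)).add
      ((Real.hasSum_cosh (l * q)).mul_left ((1 - s) / 2)))
  have h := (convexOn_pow (𝕜 := ℝ) n).2 (Set.mem_Ici.2 (sq_nonneg (l * p)))
    (Set.mem_Ici.2 (sq_nonneg (l * q))) (show 0 ≤ (1 + s) / 2 by linarith)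
    (show 0 ≤ (1 - s) / 2 by linarith) (by ring)
  simp only [smul_eq_mul] at h
  have h2 : (l * r) ^ 2 = (1 + s) / 2 * (l * p) ^ 2 + (1 - s) / 2 * (l * q) ^ 2 := by
    rw [mul_pow, hr]; ring
  rw [← h2] at h
  rw [pow_mul, pow_mul, pow_mul, mul_div_assoc', mul_div_assoc', ← add_div]
  gcongr

/-- Adding a unit vector multiplies `cosh (l ‖x‖)` by `cosh l`, up to a linear term. -/
lemma cosh_norm_add_le (l : ℝ) (x : H) {u : H} (hu : ‖u‖ = 1) :
    Real.cosh (l * ‖x + u‖) ≤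
      Real.cosh (l * ‖x‖) * Real.cosh l + ⟪dir x, u⟫ * (Real.sinh (l * ‖x‖) * Real.sinh l) := by
  have hs : |⟪dir x, u⟫| ≤ 1 := by
    refine (abs_real_inner_le_norm _ _).trans ?_
    rw [hu, mul_one]; exact norm_dir_le_one x
  -- With `s = ⟪dir x, u⟫`, the number `‖x + u‖²` is the average of `(‖x‖ + 1)²` and `(‖x‖ - 1)²`
  -- with weights `(1 ± s) / 2`.
  have h := convex_comb_cosh_sqrt (l := l) (p := ‖x‖ + 1) (q := ‖x‖ - 1) (r := ‖x + u‖) hs (by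
    rw [norm_add_sq_real, hu]
    have : ⟪x, u⟫ = ‖x‖ * ⟪dir x, u⟫ := by
      conv_lhs => rw [← norm_smul_dir x]
      rw [real_inner_smul_left]
    rw [this]; ring)
  refine h.trans_eq ?_
  rw [mul_add, mul_sub, mul_one, Real.cosh_add, Real.cosh_sub]
  ring

end Geometry

/-! ### A differentiability criterion, and positive compact operators. -/

section Compact

variable {H : Type*} [NormedAddCommGroup H] [InnerProductSpace ℝ H]

lemma hasFDerivAt_of_norm_sub_le_sq {E F : Type*} [NormedAddCommGroup E] [NormedSpace ℝ E]
    [NormedAddCommGroup F] [NormedSpace ℝ F] {f : E → F} {L : E →L[ℝ] F} {m : E} {C : ℝ}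
    (h : ∀ x, ‖f x - f m - L (x - m)‖ ≤ C * ‖x - m‖ ^ 2) : HasFDerivAt f L m := by
  have h1 : (fun x => f x - f m - L (x - m)) =O[nhds m] fun x => ‖x - m‖ ^ 2 :=
    Asymptotics.IsBigO.of_bound C (Filter.Eventually.of_forall fun x => by simpa using h x)
  rw [hasFDerivAt_iff_isLittleO]
  refine h1.trans_isLittleO ?_
  have h2 := Asymptotics.isLittleO_norm_pow_id (E' := E) (n := 2) (by norm_num)
  have h3 : Filter.Tendsto (fun x => x - m) (nhds m) (nhds 0) := by
    have : Continuous fun x : E => x - m := by fun_prop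
    simpa using this.tendsto m
  exact h2.comp_tendsto h3

/-- The norm of a positive compact operator is an eigenvalue. -/
lemma hasEigenvalue_norm_of_isCompactOperator [CompleteSpace H] [Nontrivial H] {K : H →L[ℝ] H}
    (hK : IsCompactOperator K) (hs : (K : H →ₗ[ℝ] H).IsSymmetric) (hp : ∀ v, 0 ≤ ⟪K v, v⟫) :
    Module.End.HasEigenvalue (K : H →ₗ[ℝ] H) ‖K‖ := by
  by_cases h0 : K = 0
  · obtain ⟨v, hv⟩ := exists_ne (0 : H)
    refine Module.End.hasEigenvalue_of_hasEigenvector (x := v) ⟨?_, hv⟩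
    rw [Module.End.mem_eigenspace_iff]
    simp [h0]
  -- Fredholm alternative: if `‖K‖` were in the resolvent set, the Rayleigh quotient would stay a
  -- fixed distance below `‖K‖`, its supremum for a positive symmetric operator.
  refine (IsCompactOperator.hasEigenvalue_or_mem_resolventSet hK (norm_ne_zero_iff.2 h0)).resolve_right
    fun h => ?_
  obtain ⟨ε, hε, hle⟩ := K.rayleighQuotient_le_of_norm_mem_resolventSet (𝕜 := ℝ) h
  have h1 := K.norm_eq_iSup_rayleighQuotient hs
  have h2 : (⨆ x, |K.rayleighQuotient x|) ≤ ‖K‖ - ε := by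
    refine ciSup_le fun x => ?_
    rw [abs_of_nonneg]
    · exact hle x
    · exact div_nonneg (hp x) (sq_nonneg _)
  linarith

lemma isCompactOperator_rankOne (x y : H) :
    IsCompactOperator (InnerProductSpace.rankOne ℝ x y) := by
  rw [InnerProductSpace.rankOne_def']
  have h : IsCompactOperator (innerSL ℝ y) :=
    isCompactOperator_of_locallyCompactSpace_dom (innerSL ℝ y)
  exact h.clm_comp (ContinuousLinearMap.toSpanSingleton ℝ x)

end Compact

/-! ### Spectrum of the averaged operators `𝔼[w (I - u ⊗ u)]`. -/

section Weighted

variable {H : Type*} [NormedAddCommGroup H] [InnerProductSpace ℝ H]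
  [MeasurableSpace H] [BorelSpace H] [SecondCountableTopology H]
  {Ω : Type*} [MeasurableSpace Ω] {P : Measure Ω} [IsProbabilityMeasure P]

lemma measurable_dir : Measurable (dir : H → H) :=
  measurable_norm.inv.smul measurable_id

/-- The operator `𝔼[w (I - u ⊗ u)]`, for a weight `w` and a random direction `u`. -/
noncomputable def weightedOperator (P : Measure Ω) (w : Ω → ℝ) (u : Ω → H) : H →L[ℝ] H :=
  ∫ ω, w ω • (ContinuousLinearMap.id ℝ H - InnerProductSpace.rankOne ℝ (u ω) (u ω)) ∂P

variable {w : Ω → ℝ} {u : Ω → H}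

lemma integrable_smul_rankOne (hw : Integrable w P) (hu : Measurable u) (hu1 : ∀ ω, ‖u ω‖ ≤ 1) :
    Integrable (fun ω => w ω • InnerProductSpace.rankOne ℝ (u ω) (u ω)) P := by
  refine hw.mono ?_ (Filter.Eventually.of_forall fun ω => ?_)
  · refine hw.aestronglyMeasurable.smul ?_
    have : Continuous fun x : H => InnerProductSpace.rankOne ℝ x x :=
      (InnerProductSpace.rankOne ℝ).continuous.clm_apply continuous_id
    exact (this.comp_stronglyMeasurable hu.stronglyMeasurable).aestronglyMeasurable
  · rw [norm_smul, InnerProductSpace.norm_rankOne]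
    have := mul_le_one₀ (hu1 ω) (norm_nonneg _) (hu1 ω)
    exact mul_le_of_le_one_right (norm_nonneg _) this

lemma integrable_smul_id_sub (hw : Integrable w P) (hu : Measurable u) (hu1 : ∀ ω, ‖u ω‖ ≤ 1) :
    Integrable (fun ω => w ω •
      (ContinuousLinearMap.id ℝ H - InnerProductSpace.rankOne ℝ (u ω) (u ω))) P := by
  simp only [smul_sub]
  exact (hw.smul_const _).sub (integrable_smul_rankOne hw hu hu1)

lemma weightedOperator_apply [CompleteSpace H] (hw : Integrable w P) (hu : Measurable u)
    (hu1 : ∀ ω, ‖u ω‖ ≤ 1) (v : H) :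
    weightedOperator P w u v = ∫ ω, w ω • (v - ⟪u ω, v⟫ • u ω) ∂P := by
  rw [weightedOperator, ContinuousLinearMap.integral_apply (integrable_smul_id_sub hw hu hu1)]
  simp [InnerProductSpace.rankOne_apply]

lemma integrable_weight_quadratic (hw : Integrable w P) (hu : Measurable u)
    (hu1 : ∀ ω, ‖u ω‖ ≤ 1) (v : H) :
    Integrable (fun ω => w ω * (‖v‖ ^ 2 - ⟪u ω, v⟫ ^ 2)) P := by
  refine (((integrable_smul_id_sub hw hu hu1).apply_continuousLinearMap v).const_inner v).congr
    (Filter.Eventually.of_forall fun ω => ?_)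
  simp [InnerProductSpace.rankOne_apply, real_inner_smul_right, inner_sub_right,
    real_inner_comm (u ω) v, sq]

lemma inner_weightedOperator [CompleteSpace H] (hw : Integrable w P) (hu : Measurable u)
    (hu1 : ∀ ω, ‖u ω‖ ≤ 1) (v : H) :
    ⟪v, weightedOperator P w u v⟫ = ∫ ω, w ω * (‖v‖ ^ 2 - ⟪u ω, v⟫ ^ 2) ∂P := by
  have h := (integrable_smul_id_sub hw hu hu1).apply_continuousLinearMap v
  rw [weightedOperator, ContinuousLinearMap.integral_apply (integrable_smul_id_sub hw hu hu1),
    ← integral_inner h]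
  refine integral_congr_ae (Filter.Eventually.of_forall fun ω => ?_)
  simp [InnerProductSpace.rankOne_apply, real_inner_smul_right, inner_sub_right,
    real_inner_comm (u ω) v, sq]

/-- If `u` is not almost surely parallel to a fixed vector then the smallest spectral value of
`𝔼[w (I - u ⊗ u)]` is a positive eigenvalue. -/
lemma exists_hasEigenvalue_weightedOperator [CompleteSpace H] [Nontrivial H]
    (hw : Integrable w P) (hw0 : ∀ ω, 0 ≤ w ω) (hu : Measurable u) (hu1 : ∀ ω, ‖u ω‖ ≤ 1)
    (hne : ∀ v : H, v ≠ 0 → ¬ ∀ᵐ ω ∂P, w ω * (‖v‖ ^ 2 - ⟪u ω, v⟫ ^ 2) = 0) :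
    ∃ l : ℝ, 0 < l ∧ Module.End.HasEigenvalue (weightedOperator P w u : H →ₗ[ℝ] H) l ∧
      ∀ v, l * ‖v‖ ^ 2 ≤ ⟪v, weightedOperator P w u v⟫ := by
  set K : H →L[ℝ] H := ∫ ω, w ω • InnerProductSpace.rankOne ℝ (u ω) (u ω) ∂P with hKdef
  have hKi := integrable_smul_rankOne hw hu hu1
  have hBK : weightedOperator P w u = (∫ ω, w ω ∂P) • ContinuousLinearMap.id ℝ H - K := by
    rw [weightedOperator]
    simp only [smul_sub]
    rw [integral_sub (hw.smul_const _) hKi, integral_smul_const]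
  have hKa : ∀ v x, ⟪x, K v⟫ = ∫ ω, w ω * (⟪u ω, v⟫ * ⟪u ω, x⟫) ∂P := by
    intro v x
    rw [hKdef, ContinuousLinearMap.integral_apply hKi,
      ← integral_inner (hKi.apply_continuousLinearMap v)]
    refine integral_congr_ae (Filter.Eventually.of_forall fun ω => ?_)
    simp [InnerProductSpace.rankOne_apply, real_inner_smul_right, real_inner_comm (u ω) x]
  -- Compact operators form a closed convex set, so the average of rank-one operators stays in it.
  have hcomp : IsCompactOperator K := by
    have hconv : Convex ℝ {f : H →L[ℝ] H | IsCompactOperator f} :=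
      (compactOperator (RingHom.id ℝ) H H).convex
    refine hconv.integral_mem isClosed_setOfPred_isCompactOperator
      (Filter.Eventually.of_forall fun ω => ?_) hKi
    exact (isCompactOperator_rankOne (u ω) (u ω)).smul (w ω)
  have hsym : (K : H →ₗ[ℝ] H).IsSymmetric := by
    intro x y
    change ⟪K x, y⟫ = ⟪x, K y⟫
    rw [real_inner_comm, hKa, hKa]
    simp only [mul_comm]
  have hpos : ∀ v, 0 ≤ ⟪K v, v⟫ := by
    intro v
    rw [real_inner_comm, hKa]
    exact integral_nonneg fun ω => mul_nonneg (hw0 ω) (mul_self_nonneg _)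
  obtain ⟨v, hv⟩ := (hasEigenvalue_norm_of_isCompactOperator hcomp hsym hpos).exists_hasEigenvector
  have hv2 : K v = ‖K‖ • v := hv.apply_eq_smul
  have hBv : weightedOperator P w u v = ((∫ ω, w ω ∂P) - ‖K‖) • v := by
    rw [hBK, sub_apply, hv2, sub_smul]; rfl
  refine ⟨(∫ ω, w ω ∂P) - ‖K‖, ?_, ?_, ?_⟩
  · have hi := inner_weightedOperator hw hu hu1 v
    rw [hBv, real_inner_smul_right, real_inner_self_eq_norm_sq] at hi
    have hnn : ∀ ω, 0 ≤ w ω * (‖v‖ ^ 2 - ⟪u ω, v⟫ ^ 2) := by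
      intro ω
      refine mul_nonneg (hw0 ω) (sub_nonneg.2 ?_)
      rw [sq_le_sq, abs_norm]
      exact (abs_real_inner_le_norm _ _).trans (mul_le_of_le_one_left (norm_nonneg _) (hu1 ω))
    have : 0 < ∫ ω, w ω * (‖v‖ ^ 2 - ⟪u ω, v⟫ ^ 2) ∂P := by
      refine lt_of_le_of_ne (integral_nonneg hnn) fun h0 => hne v hv.2 ?_
      exact (integral_eq_zero_iff_of_nonneg hnn (integrable_weight_quadratic hw hu hu1 v)).1 h0.symm
    rw [← hi] at this
    exact pos_of_mul_pos_left this (sq_nonneg _)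
  · exact Module.End.hasEigenvalue_of_hasEigenvector (x := v)
      ⟨Module.End.mem_eigenspace_iff.2 hBv, hv.2⟩
  · intro x
    rw [hBK, sub_apply, inner_sub_right, smul_apply,
      ContinuousLinearMap.id_apply, real_inner_smul_right, real_inner_self_eq_norm_sq, sub_mul]
    have h1 : ⟪x, K x⟫ ≤ ‖x‖ * (‖K‖ * ‖x‖) :=
      (real_inner_le_norm _ _).trans (mul_le_mul_of_nonneg_left (K.le_opNorm x) (norm_nonneg _))
    nlinarith

end Weighted

/-! ### Gradient, Hessian and monotonicity of the criterion. -/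

section Median

variable {H : Type*} [NormedAddCommGroup H] [InnerProductSpace ℝ H]
  [MeasurableSpace H] [BorelSpace H] [SecondCountableTopology H]
  {Ω : Type*} [MeasurableSpace Ω] {P : Measure Ω} [IsProbabilityMeasure P] {X : Ω → H}

/-- With `1 / 0 = ∞`, a finite inverse moment forbids an atom at `a`. The real-valued integrand, for
which `0⁻¹ = 0`, then agrees almost everywhere with the extended one. -/
lemma BoundedInverseMoment.integrable (hX : Measurable X) {p : ℕ} (hp : p ≠ 0)
    (h : BoundedInverseMoment P X p) :
    ∃ C : ℝ, 0 < C ∧ ∀ a : H, (∀ᵐ ω ∂P, X ω ≠ a) ∧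
      Integrable (fun ω => (‖X ω - a‖ ^ p)⁻¹) P ∧ ∫ ω, (‖X ω - a‖ ^ p)⁻¹ ∂P ≤ C := by
  obtain ⟨C, hC, hle⟩ := h
  refine ⟨C, hC, fun a => ?_⟩
  have hm : Measurable fun ω => X ω - a := hX.sub_const a
  have hfin : ∫⁻ ω, (‖X ω - a‖ₑ ^ p)⁻¹ ∂P ≠ ⊤ := ((hle a).trans_lt ENNReal.ofReal_lt_top).ne
  have hne : ∀ᵐ ω ∂P, X ω ≠ a := by
    filter_upwards [ae_lt_top (hm.enorm.pow_const p).inv hfin] with ω hω h0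
    simp [h0, hp] at hω
  have heq : ∀ᵐ ω ∂P, ‖(‖X ω - a‖ ^ p)⁻¹‖ₑ = (‖X ω - a‖ₑ ^ p)⁻¹ := by
    filter_upwards [hne] with ω hω
    have h0 : ‖X ω - a‖ ^ p ≠ 0 := pow_ne_zero _ (norm_ne_zero_iff.2 (sub_ne_zero.2 hω))
    rw [enorm_inv h0, enorm_pow, enorm_norm]
  have hint : Integrable (fun ω => (‖X ω - a‖ ^ p)⁻¹) P := by
    refine ⟨(hm.norm.pow_const p).inv.aestronglyMeasurable, ?_⟩
    rw [hasFiniteIntegral_iff_enorm, lintegral_congr_ae heq]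
    exact hfin.lt_top
  refine ⟨hne, hint, ?_⟩
  rw [integral_eq_lintegral_of_nonneg_ae (Filter.Eventually.of_forall fun ω => by positivity)
    hint.aestronglyMeasurable]
  refine ENNReal.toReal_le_of_le_ofReal hC.le (le_trans (le_of_eq ?_) (hle a))
  refine lintegral_congr_ae ?_
  filter_upwards [heq] with ω hω
  rw [← hω, Real.enorm_eq_ofReal (by positivity)]

/-- The gradient `-𝔼[(X - h) / ‖X - h‖]` of the criterion. -/
noncomputable def medianGradient (P : Measure Ω) (X : Ω → H) (h : H) : H :=
  -∫ ω, dir (X ω - h) ∂P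

lemma integrable_dir_sub (hX : Measurable X) (h : H) : Integrable (fun ω => dir (X ω - h)) P :=
  Integrable.of_bound (measurable_dir.comp (hX.sub_const h)).aestronglyMeasurable 1
    (Filter.Eventually.of_forall fun _ => norm_dir_le_one _)

lemma norm_medianGradient_le_one (h : H) : ‖medianGradient P X h‖ ≤ 1 := by
  rw [medianGradient, norm_neg]
  simpa using norm_integral_le_of_norm_le_const (μ := P)
    (Filter.Eventually.of_forall fun _ => norm_dir_le_one _)

/-- The first-order error is the mean of `‖X - a‖ - ⟪dir (X - h), X - a⟫`, which lies between 0 and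
`2 ‖a - h‖² / ‖X - h‖`. The first inverse moment makes it quadratic in `a - h`. -/
lemma hasGradientAt_medianObjective [CompleteSpace H] (hX : Measurable X)
    (hA2 : BoundedInverseMoment P X 1) (h : H) :
    HasGradientAt (medianObjective P X) (medianGradient P X h) h := by
  obtain ⟨C, hC, hinv⟩ := hA2.integrable hX one_ne_zero
  obtain ⟨hne, hint, hle⟩ := hinv h
  simp only [pow_one] at hint hle
  have hF : ∀ a, Integrable (fun ω => ‖X ω - a‖ - ‖X ω‖) P := fun a =>
    Integrable.of_bound ((hX.sub_const a).norm.sub hX.norm).aestronglyMeasurable ‖a‖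
      (Filter.Eventually.of_forall fun ω => by
        rw [Real.norm_eq_abs]
        simpa using abs_norm_sub_norm_le (X ω - a) (X ω))
  rw [hasGradientAt_iff_hasFDerivAt]
  refine hasFDerivAt_of_norm_sub_le_sq (C := 2 * C) fun a => ?_
  have hd := integrable_dir_sub (P := P) hX h
  have hs : Integrable (fun ω => (‖X ω - a‖ - ‖X ω‖) - (‖X ω - h‖ - ‖X ω‖)) P :=
    (hF a).sub (hF h)
  have h1 : medianObjective P X a - medianObjective P X h -
      InnerProductSpace.toDual ℝ H (medianGradient P X h) (a - h) =
      ∫ ω, (‖X ω - a‖ - ⟪dir (X ω - h), X ω - a⟫) ∂P := by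
    rw [InnerProductSpace.toDual_apply_apply, medianGradient, inner_neg_left, real_inner_comm,
      ← integral_inner hd, medianObjective, medianObjective, ← integral_sub (hF a) (hF h),
      ← integral_neg, ← integral_sub hs (hd.const_inner (a - h)).fun_neg]
    refine integral_congr_ae (Filter.Eventually.of_forall fun ω => ?_)
    have : ⟪dir (X ω - h), X ω - a⟫ = ‖X ω - h‖ - ⟪a - h, dir (X ω - h)⟫ := by
      rw [← inner_dir_self (X ω - h), real_inner_comm _ (a - h), ← inner_sub_right]
      congr 1; abel
    simp only [this]
    ring
  rw [h1]
  refine (norm_integral_le_of_norm_le (hint.const_mul (2 * ‖a - h‖ ^ 2)) ?_).trans ?_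
  · filter_upwards [hne] with ω hω
    have hω' : X ω - h ≠ 0 := sub_ne_zero.2 hω
    have e : (X ω - h) - (X ω - a) = a - h := by abel
    have h2 := norm_dir_sub_dir_le hω' (X ω - a)
    have h3 := norm_sub_inner_dir_le (X ω - h) (X ω - a)
    have h5 := mul_le_mul_of_nonneg_right h2 (norm_nonneg (a - h))
    rw [e] at h2 h5 h3
    rw [Real.norm_eq_abs, abs_of_nonneg (sub_nonneg.2 (inner_dir_le _ _))]
    linarith
  · rw [integral_const_mul]
    nlinarith [sq_nonneg ‖a - h‖]

lemma gradient_medianObjective [CompleteSpace H] (hX : Measurable X)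
    (hA2 : BoundedInverseMoment P X 1) :
    gradient (medianObjective P X) = medianGradient P X :=
  gradient_eq fun h => hasGradientAt_medianObjective hX hA2 h

lemma IsGeometricMedian.medianGradient_eq_zero [CompleteSpace H] (hX : Measurable X)
    (hA2 : BoundedInverseMoment P X 1) {m : H} (hm : IsGeometricMedian P X m) :
    medianGradient P X m = 0 := by
  have h1 := (hasGradientAt_medianObjective hX hA2 m).hasFDerivAt
  have h2 : IsLocalMin (medianObjective P X) m := Filter.Eventually.of_forall hm
  simpa using h2.hasFDerivAt_eq_zero h1

lemma medianHessian_eq_weightedOperator (m : H) :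
    medianHessian P X m =
      weightedOperator P (fun ω => ‖X ω - m‖⁻¹) (fun ω => dir (X ω - m)) := by
  rw [medianHessian, weightedOperator]
  refine integral_congr_ae (Filter.Eventually.of_forall fun ω => ?_)
  simp only [dir, map_smul, smul_apply, smul_smul]
  simp [sq]

/-- The second order Taylor bound for the gradient of the criterion. -/
lemma norm_medianGradient_sub_le [CompleteSpace H] (hX : Measurable X)
    (hA2 : BoundedInverseMoment P X 1) (hA3 : BoundedInverseMoment P X 2) (m : H) :
    ∃ C : ℝ, 0 ≤ C ∧ ∀ h, ‖medianGradient P X h - medianGradient P X m -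
      medianHessian P X m (h - m)‖ ≤ C * ‖h - m‖ ^ 2 := by
  obtain ⟨C, hC, hinv⟩ := hA3.integrable hX two_ne_zero
  obtain ⟨hne, hint, hle⟩ := hinv m
  obtain ⟨_, _, hinv'⟩ := hA2.integrable hX one_ne_zero
  have hw : Integrable (fun ω => ‖X ω - m‖⁻¹) P := by simpa using (hinv' m).2.1
  have hu : Measurable fun ω => dir (X ω - m) := measurable_dir.comp (hX.sub_const m)
  have hu1 : ∀ ω, ‖dir (X ω - m)‖ ≤ 1 := fun ω => norm_dir_le_one _
  refine ⟨4 * C, by positivity, fun h => ?_⟩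
  have hop := (integrable_smul_id_sub hw hu hu1).apply_continuousLinearMap (h - m)
  have h1 : medianGradient P X h - medianGradient P X m - medianHessian P X m (h - m) =
      ∫ ω, (dir (X ω - m) - dir (X ω - h) -
        ‖X ω - m‖⁻¹ • ((h - m) - ⟪dir (X ω - m), h - m⟫ • dir (X ω - m))) ∂P := by
    have hop' : Integrable (fun ω =>
        ‖X ω - m‖⁻¹ • ((h - m) - ⟪dir (X ω - m), h - m⟫ • dir (X ω - m))) P := by
      simpa [InnerProductSpace.rankOne_apply] using hop
    have hs : Integrable (fun ω => dir (X ω - m) - dir (X ω - h)) P :=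
      (integrable_dir_sub hX m).sub (integrable_dir_sub hX h)
    rw [medianHessian_eq_weightedOperator, weightedOperator_apply hw hu hu1, medianGradient,
      medianGradient, integral_sub hs hop',
      integral_sub (integrable_dir_sub hX m) (integrable_dir_sub hX h)]
    abel
  rw [h1]
  refine (norm_integral_le_of_norm_le (hint.const_mul (4 * ‖h - m‖ ^ 2)) ?_).trans ?_
  · filter_upwards [hne] with ω hω
    have e : (X ω - m) - (X ω - h) = h - m := by abel
    simpa only [e] using norm_dir_sub_dir_sub_le (sub_ne_zero.2 hω) (X ω - h)
  · rw [integral_const_mul]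
    nlinarith [sq_nonneg ‖h - m‖]

lemma NotConcentratedOnLine.nontrivial (hA1 : NotConcentratedOnLine P X) : Nontrivial H := by
  by_contra hH
  rw [not_nontrivial_iff_subsingleton] at hH
  obtain ⟨h', -, hv⟩ := hA1 0
  have : (fun ω => ⟪h', X ω⟫) = fun _ => (0 : ℝ) := by
    ext ω; rw [Subsingleton.elim h' 0, inner_zero_left]
  rw [this] at hv
  have h0 : evariance (fun _ : Ω => (0 : ℝ)) P = 0 :=
    (evariance_eq_zero_iff aemeasurable_const).2 (by simp)
  exact hv.ne' h0

/-- Vanishing is the equality case of Cauchy–Schwarz: `X - m` would be almost surely parallel to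
`v`. Then `⟪h', X⟫` would be almost surely constant for every `h'` orthogonal to `v`. -/
lemma NotConcentratedOnLine.not_ae_eq_zero (hA1 : NotConcentratedOnLine P X) {m : H} (hne : ∀ᵐ ω ∂P, X ω ≠ m) {w : Ω → ℝ}
    (hw : ∀ᵐ ω ∂P, 0 < w ω) {v : H} (hv : v ≠ 0) :
    ¬ ∀ᵐ ω ∂P, w ω * (‖v‖ ^ 2 - ⟪dir (X ω - m), v⟫ ^ 2) = 0 := by
  intro h0
  obtain ⟨h', horth, hvar⟩ := hA1 v
  have hc : ∀ᵐ ω ∂P, ⟪h', X ω⟫ = ⟪h', m⟫ := by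
    filter_upwards [h0, hne, hw] with ω h1 h2 h3
    have h4 : ‖v‖ ^ 2 - ⟪dir (X ω - m), v⟫ ^ 2 = 0 := (mul_eq_zero.1 h1).resolve_left h3.ne'
    have h5 : ‖v - ⟪dir (X ω - m), v⟫ • dir (X ω - m)‖ ^ 2 = 0 := by
      rw [norm_sub_sq_real, norm_smul, norm_dir (sub_ne_zero.2 h2), real_inner_smul_right,
        Real.norm_eq_abs, mul_one, sq_abs, real_inner_comm _ v]
      linarith
    have h6 : v = ⟪dir (X ω - m), v⟫ • dir (X ω - m) := by
      rw [← sub_eq_zero, ← norm_eq_zero]; exact pow_eq_zero_iff two_ne_zero |>.1 h5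
    have h7 : ⟪dir (X ω - m), v⟫ ≠ 0 := by
      intro h8; rw [h8, zero_smul] at h6; exact hv h6
    have h8 : ⟪h', dir (X ω - m)⟫ = 0 := by
      rw [real_inner_comm, h6, real_inner_smul_right] at horth
      exact (mul_eq_zero.1 horth).resolve_left h7
    rw [← sub_eq_zero, ← inner_sub_right, ← norm_smul_dir (X ω - m), real_inner_smul_right, h8,
      mul_zero]
  have h1 : evariance (fun ω => ⟪h', X ω⟫) P = 0 := by
    rw [evariance_congr (Y := fun _ => ⟪h', m⟫) hc]
    refine (evariance_eq_zero_iff aemeasurable_const).2 ?_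
    simp
  exact hvar.ne' h1

/-- The Hessian at the median has a positive smallest spectral value, which is an eigenvalue. -/
lemma exists_hasEigenvalue_medianHessian [CompleteSpace H] (hX : Measurable X)
    (hA1 : NotConcentratedOnLine P X) (hA2 : BoundedInverseMoment P X 1) (m : H) :
    ∃ l : ℝ, 0 < l ∧ Module.End.HasEigenvalue (medianHessian P X m : H →ₗ[ℝ] H) l ∧
      ∀ v, l * ‖v‖ ^ 2 ≤ ⟪v, medianHessian P X m v⟫ := by
  have := hA1.nontrivial
  obtain ⟨_, _, hinv⟩ := hA2.integrable hX one_ne_zero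
  obtain ⟨hne, hint, -⟩ := hinv m
  rw [medianHessian_eq_weightedOperator]
  refine exists_hasEigenvalue_weightedOperator (by simpa using hint) (fun _ => by positivity)
    (measurable_dir.comp (hX.sub_const m)) (fun ω => norm_dir_le_one _) fun v hv =>
      hA1.not_ae_eq_zero hne ?_ hv
  filter_upwards [hne] with ω hω
  exact inv_pos.2 (norm_pos_iff.2 (sub_ne_zero.2 hω))

/-- Strong monotonicity of the gradient on balls around the median. -/
lemma exists_le_inner_medianGradient [CompleteSpace H] (hX : Measurable X)
    (hA1 : NotConcentratedOnLine P X) (hA2 : BoundedInverseMoment P X 1) {m : H}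
    (hm : IsGeometricMedian P X m) {A : ℝ} (hA : 0 < A) :
    ∃ c : ℝ, 0 < c ∧ ∀ h, ‖h - m‖ ≤ A → c * ‖h - m‖ ^ 2 ≤ ⟪medianGradient P X h, h - m⟫ := by
  have := hA1.nontrivial
  obtain ⟨_, _, hinv⟩ := hA2.integrable hX one_ne_zero
  have hne := (hinv m).1
  have hpos : ∀ ω, 0 < (‖X ω - m‖ + A)⁻¹ := fun ω => by positivity
  -- On the ball of radius `A` this bounded weight lies below the weight `(‖X - m‖ + ‖h - m‖)⁻¹` of
  -- `inner_dir_sub_dir_ge`, and it does not depend on `h`.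
  have hw : Integrable (fun ω => (‖X ω - m‖ + A)⁻¹) P := by
    refine Integrable.of_bound ((hX.sub_const m).norm.add_const A).inv.aestronglyMeasurable A⁻¹
      (Filter.Eventually.of_forall fun ω => ?_)
    rw [Real.norm_eq_abs, abs_of_pos (hpos ω)]
    gcongr
    linarith [norm_nonneg (X ω - m)]
  have hu : Measurable fun ω => dir (X ω - m) := measurable_dir.comp (hX.sub_const m)
  have hu1 : ∀ ω, ‖dir (X ω - m)‖ ≤ 1 := fun ω => norm_dir_le_one _
  obtain ⟨l, hl, -, hle⟩ := exists_hasEigenvalue_weightedOperator hw (fun ω => (hpos ω).le) hu hu1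
    fun v hv => hA1.not_ae_eq_zero hne (Filter.Eventually.of_forall hpos) hv
  refine ⟨l / 2, by positivity, fun h hh => ?_⟩
  have h1 := hle (h - m)
  rw [inner_weightedOperator hw hu hu1] at h1
  have hd := (integrable_dir_sub (P := P) hX m).sub (integrable_dir_sub (P := P) hX h)
  have h2 : ⟪medianGradient P X h, h - m⟫ =
      ∫ ω, ⟪h - m, dir (X ω - m) - dir (X ω - h)⟫ ∂P := by
    have e : medianGradient P X h = medianGradient P X h - medianGradient P X m := by
      rw [hm.medianGradient_eq_zero hX hA2, sub_zero]
    rw [e, real_inner_comm]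
    refine Eq.trans ?_ (integral_inner hd (h - m)).symm
    rw [integral_sub' (integrable_dir_sub hX m) (integrable_dir_sub hX h), medianGradient,
      medianGradient]
    congr 1; abel
  have h3 : ∫ ω, (‖X ω - m‖ + A)⁻¹ * (‖h - m‖ ^ 2 - ⟪dir (X ω - m), h - m⟫ ^ 2) ∂P ≤
      ∫ ω, 2 * ⟪h - m, dir (X ω - m) - dir (X ω - h)⟫ ∂P := by
    refine integral_mono_ae (integrable_weight_quadratic hw hu hu1 (h - m))
      ((hd.const_inner (h - m)).const_mul 2) ?_
    filter_upwards [hne] with ω hω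
    have e : (X ω - m) - (X ω - h) = h - m := by abel
    have h4 := inner_dir_sub_dir_ge (sub_ne_zero.2 hω) (X ω - h)
    rw [e] at h4
    refine le_trans ?_ (h4.trans_eq (by rw [real_inner_comm]))
    have hω' : 0 < ‖X ω - m‖ := norm_pos_iff.2 (sub_ne_zero.2 hω)
    have : 0 ≤ ‖h - m‖ ^ 2 - ⟪dir (X ω - m), h - m⟫ ^ 2 := by
      refine sub_nonneg.2 ?_
      rw [sq_le_sq, abs_norm]
      exact (abs_real_inner_le_norm _ _).trans (mul_le_of_le_one_left (norm_nonneg _) (hu1 ω))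
    gcongr
  rw [integral_const_mul, ← h2] at h3
  linarith

lemma norm_medianGradient_sub_le_mul (hX : Measurable X) (hA2 : BoundedInverseMoment P X 1)
    (m : H) : ∃ C : ℝ, 0 ≤ C ∧ ∀ h,
      ‖medianGradient P X h - medianGradient P X m‖ ≤ C * ‖h - m‖ := by
  obtain ⟨C, hC, hinv⟩ := hA2.integrable hX one_ne_zero
  obtain ⟨hne, hint, hle⟩ := hinv m
  simp only [pow_one] at hint hle
  refine ⟨2 * C, by positivity, fun h => ?_⟩
  have h1 : medianGradient P X h - medianGradient P X m =
      ∫ ω, (dir (X ω - m) - dir (X ω - h)) ∂P := by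
    rw [integral_sub (integrable_dir_sub hX m) (integrable_dir_sub hX h), medianGradient,
      medianGradient]
    abel
  rw [h1]
  refine (norm_integral_le_of_norm_le (hint.const_mul (2 * ‖h - m‖)) ?_).trans ?_
  · filter_upwards [hne] with ω hω
    have e : (X ω - m) - (X ω - h) = h - m := by abel
    simpa only [e] using norm_dir_sub_dir_le (sub_ne_zero.2 hω) (X ω - h)
  · rw [integral_const_mul]
    nlinarith [norm_nonneg (h - m)]

lemma measurable_medianGradient (hX : Measurable X) :
    Measurable (medianGradient P X) := by
  have h : StronglyMeasurable (Function.uncurry fun (h : H) (ω : Ω) => dir (X ω - h)) :=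
    (measurable_dir.comp ((hX.comp measurable_snd).sub measurable_fst)).stronglyMeasurable
  exact h.integral_prod_right.measurable.neg

lemma integral_norm_dir_sub_dir_sq_le (hX : Measurable X) (hA3 : BoundedInverseMoment P X 2)
    (m : H) : ∃ C : ℝ, 0 ≤ C ∧ ∀ h,
      ∫ ω, ‖dir (X ω - m) - dir (X ω - h)‖ ^ 2 ∂P ≤ C * ‖h - m‖ ^ 2 := by
  obtain ⟨C, hC, hinv⟩ := hA3.integrable hX two_ne_zero
  obtain ⟨hne, hint, hle⟩ := hinv m
  refine ⟨4 * C, by positivity, fun h => ?_⟩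
  have h1 : ∫ ω, ‖dir (X ω - m) - dir (X ω - h)‖ ^ 2 ∂P ≤
      ∫ ω, 4 * ‖h - m‖ ^ 2 * (‖X ω - m‖ ^ 2)⁻¹ ∂P := by
    refine integral_mono_of_nonneg (Filter.Eventually.of_forall fun ω => by positivity)
      (hint.const_mul _) ?_
    filter_upwards [hne] with ω hω
    have e : (X ω - m) - (X ω - h) = h - m := by abel
    have h2 := norm_dir_sub_dir_le (sub_ne_zero.2 hω) (X ω - h)
    rw [e] at h2
    refine (pow_le_pow_left₀ (norm_nonneg _) h2 2).trans_eq ?_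
    rw [mul_pow, mul_pow, inv_pow]; ring
  refine h1.trans ?_
  rw [integral_const_mul]
  nlinarith [sq_nonneg ‖h - m‖]

end Median

/-! ### The truncated algorithm: quadratic error, exit probability, noise. -/

section Algorithm

variable {H : Type*} [NormedAddCommGroup H] [InnerProductSpace ℝ H] [MeasurableSpace H]
  {Ω : Type*} {mΩ : MeasurableSpace Ω}

/-- `z` is the stochastic gradient algorithm for the geometric median of `X`, driven by a sample
`x` of copies of `X` such that `x k` is independent of the past `F k`. -/
structure IsMedianSGD (P : Measure Ω) (X : Ω → H) (γ : ℕ → ℝ) (F : Filtration ℕ mΩ)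
    (x z : ℕ → Ω → H) : Prop where
  -- The observation `x k` moves `z k` to `z (k + 1)`, so it becomes known at time `k + 1`.
  measurable_sample : ∀ k, Measurable[F (k + 1)] (x k)
  indep_sample : ∀ k, Indep (F k) (MeasurableSpace.comap (x k) inferInstance) P
  ident_sample : ∀ k, IdentDistrib (x k) X P P
  measurable_zero : Measurable[F 0] (z 0)
  step : ∀ k ω, z (k + 1) ω = z k ω + γ k • dir (x k ω - z k ω)

variable [BorelSpace H] [SecondCountableTopology H]
  {P : Measure Ω} [IsProbabilityMeasure P] {X : Ω → H} {γ : ℕ → ℝ} {F : Filtration ℕ mΩ}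
  {x z : ℕ → Ω → H} {m : H}

/-- The event that the iterates up to time `k` stay at distance at most `A` of `m`. -/
def stay (z : ℕ → Ω → H) (m : H) (A : ℝ) (k : ℕ) : Set Ω := {ω | ∀ j ≤ k, ‖z j ω - m‖ ≤ A}

/-- The indicator function of `stay z m A k`. -/
noncomputable def stayInd (z : ℕ → Ω → H) (m : H) (A : ℝ) (k : ℕ) : Ω → ℝ :=
  (stay z m A k).indicator 1

lemma stayInd_of_mem {A : ℝ} {k : ℕ} {ω : Ω} (h : ω ∈ stay z m A k) : stayInd z m A k ω = 1 :=
  Set.indicator_of_mem h _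

lemma stayInd_of_notMem {A : ℝ} {k : ℕ} {ω : Ω} (h : ω ∉ stay z m A k) :
    stayInd z m A k ω = 0 :=
  Set.indicator_of_notMem h _

lemma stayInd_nonneg (A : ℝ) (k : ℕ) (ω : Ω) : 0 ≤ stayInd z m A k ω :=
  Set.indicator_nonneg (fun _ _ => zero_le_one) _

lemma stayInd_le_one (A : ℝ) (k : ℕ) (ω : Ω) : stayInd z m A k ω ≤ 1 := by
  by_cases h : ω ∈ stay z m A k
  · rw [stayInd_of_mem h]
  · rw [stayInd_of_notMem h]; exact zero_le_one

lemma stayInd_sq (A : ℝ) (k : ℕ) (ω : Ω) : stayInd z m A k ω ^ 2 = stayInd z m A k ω := by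
  by_cases h : ω ∈ stay z m A k
  · rw [stayInd_of_mem h, one_pow]
  · rw [stayInd_of_notMem h]; norm_num

lemma stayInd_mul_le {A : ℝ} (hA : 0 ≤ A) (k : ℕ) (ω : Ω) :
    stayInd z m A k ω * ‖z k ω - m‖ ≤ A := by
  by_cases h : ω ∈ stay z m A k
  · rw [stayInd_of_mem h, one_mul]; exact h k le_rfl
  · rw [stayInd_of_notMem h, zero_mul]; exact hA

lemma stayInd_mul_sq_le (A : ℝ) (k : ℕ) (ω : Ω) :
    stayInd z m A k ω * ‖z k ω - m‖ ^ 2 ≤ A ^ 2 := by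
  by_cases h : ω ∈ stay z m A k
  · rw [stayInd_of_mem h, one_mul]; exact pow_le_pow_left₀ (norm_nonneg _) (h k le_rfl) 2
  · rw [stayInd_of_notMem h, zero_mul]; exact sq_nonneg _

namespace IsMedianSGD

lemma measurable_iter (h : IsMedianSGD P X γ F x z) : ∀ k, Measurable[F k] (z k)
  | 0 => h.measurable_zero
  | k + 1 => by
    have hz : Measurable[F (k + 1)] (z k) := (h.measurable_iter k).mono (F.mono k.le_succ) le_rfl
    have : z (k + 1) = fun ω => z k ω + γ k • dir (x k ω - z k ω) := funext (h.step k)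
    rw [this]
    exact hz.add ((measurable_dir.comp ((h.measurable_sample k).sub hz)).const_smul (γ k))

lemma measurable_iter' (h : IsMedianSGD P X γ F x z) (k : ℕ) : Measurable (z k) :=
  (h.measurable_iter k).mono (F.le k) le_rfl

lemma measurable_sample' (h : IsMedianSGD P X γ F x z) (k : ℕ) : Measurable (x k) :=
  (h.measurable_sample k).mono (F.le _) le_rfl

lemma measurableSet_stay (h : IsMedianSGD P X γ F x z) (A : ℝ) (k : ℕ) :
    MeasurableSet[F k] (stay z m A k) := by
  have : stay z m A k = ⋂ j ∈ Finset.range (k + 1), {ω | ‖z j ω - m‖ ≤ A} := by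
    ext ω; simp [stay]
  rw [this]
  refine Finset.measurableSet_biInter _ fun j hj => ?_
  have hz : Measurable[F k] (z j) :=
    (h.measurable_iter j).mono (F.mono (Nat.lt_succ_iff.1 (Finset.mem_range.1 hj))) le_rfl
  exact hz (measurableSet_le (measurable_id.sub_const m).norm measurable_const)

lemma measurable_stayInd (h : IsMedianSGD P X γ F x z) (A : ℝ) (k : ℕ) :
    Measurable[F k] (stayInd z m A k) :=
  Measurable.indicator measurable_const (h.measurableSet_stay A k)

lemma measurable_stayInd' (h : IsMedianSGD P X γ F x z) (A : ℝ) (k : ℕ) :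
    Measurable (stayInd z m A k) :=
  (h.measurable_stayInd A k).mono (F.le k) le_rfl

/-- Integrating out the fresh observation. -/
lemma integral_sample (h : IsMedianSGD P X γ F x z) (hX : Measurable X) {E : Type*}
    [MeasurableSpace E] {k : ℕ} {W : Ω → E} (hW : Measurable[F k] W) {g : E → H → ℝ}
    (hg : Measurable (Function.uncurry g)) (hint : Integrable (fun ω => g (W ω) (x k ω)) P) :
    Integrable (fun ω => ∫ ω', g (W ω) (X ω') ∂P) P ∧
      ∫ ω, g (W ω) (x k ω) ∂P = ∫ ω, ∫ ω', g (W ω) (X ω') ∂P ∂P := by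
  have hW' : Measurable W := hW.mono (F.le k) le_rfl
  have hxk := h.measurable_sample' k
  have hind : IndepFun W (x k) P := by
    rw [IndepFun_iff_Indep]
    exact indep_of_indep_of_le_left (h.indep_sample k) hW.comap_le
  have hmap : P.map (fun ω => (W ω, x k ω)) = (P.map W).prod (P.map X) := by
    rw [hind.map_prod_eq_prod_map_map hW'.aemeasurable hxk.aemeasurable,
      (h.ident_sample k).map_eq]
  have : IsProbabilityMeasure (P.map X) := Measure.isProbabilityMeasure_map hX.aemeasurable
  have : IsProbabilityMeasure (P.map W) := Measure.isProbabilityMeasure_map hW'.aemeasurable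
  have hi : ∀ e, ∫ ω', g e (X ω') ∂P = ∫ y, g e y ∂(P.map X) := fun e =>
    (integral_map hX.aemeasurable
      (hg.comp measurable_prodMk_left).aestronglyMeasurable).symm
  have hm : AEMeasurable (fun ω => (W ω, x k ω)) P := (hW'.prodMk hxk).aemeasurable
  have hint' : Integrable (Function.uncurry g) ((P.map W).prod (P.map X)) := by
    rw [← hmap, integrable_map_measure hg.aestronglyMeasurable hm]
    exact hint
  have hmi : StronglyMeasurable fun e => ∫ y, g e y ∂(P.map X) :=
    hg.stronglyMeasurable.integral_prod_right
  simp only [hi]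
  constructor
  · exact (integrable_map_measure hmi.aestronglyMeasurable hW'.aemeasurable).1
      hint'.integral_prod_left
  · rw [← integral_map hW'.aemeasurable hmi.aestronglyMeasurable]
    refine Eq.trans ?_ (integral_prod (Function.uncurry g) hint')
    rw [← hmap, integral_map hm hg.aestronglyMeasurable]
    rfl

lemma integrable_inner_dir (h : IsMedianSGD P X γ F x z) {k : ℕ} {Y ζ : Ω → H}
    (hY : Measurable[F k] Y) (hζ : Measurable[F k] ζ) {B : ℝ} (hB : ∀ ω, ‖Y ω‖ ≤ B) :
    Integrable (fun ω => ⟪Y ω, dir (x k ω - ζ ω)⟫) P := by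
  have hY' : Measurable Y := hY.mono (F.le k) le_rfl
  have hζ' : Measurable ζ := hζ.mono (F.le k) le_rfl
  refine Integrable.of_bound (hY'.inner (measurable_dir.comp
    ((h.measurable_sample' k).sub hζ'))).aestronglyMeasurable B
    (Filter.Eventually.of_forall fun ω => ?_)
  refine (norm_inner_le_norm _ _).trans ?_
  exact (mul_le_of_le_one_right (norm_nonneg _) (norm_dir_le_one _)).trans (hB ω)

/-- Given the past, the fresh direction seen from `ζ` has mean minus the gradient at `ζ`. This is
used both with `ζ = z k` and with the constant `m`. -/
lemma integral_inner_dir [CompleteSpace H] (h : IsMedianSGD P X γ F x z) (hX : Measurable X)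
    {k : ℕ} {Y ζ : Ω → H}
    (hY : Measurable[F k] Y) (hζ : Measurable[F k] ζ) {B : ℝ} (hB : ∀ ω, ‖Y ω‖ ≤ B) :
    ∫ ω, ⟪Y ω, dir (x k ω - ζ ω)⟫ ∂P = -∫ ω, ⟪Y ω, medianGradient P X (ζ ω)⟫ ∂P := by
  have h1 := (h.integral_sample hX (W := fun ω => (Y ω, ζ ω)) (hY.prodMk hζ)
    (g := fun p y => ⟪p.1, dir (y - p.2)⟫)
    ((measurable_fst.comp measurable_fst).inner (measurable_dir.comp
      (measurable_snd.sub (measurable_snd.comp measurable_fst))))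
    (h.integrable_inner_dir hY hζ hB)).2
  refine h1.trans ?_
  rw [← integral_neg]
  refine integral_congr_ae (Filter.Eventually.of_forall fun ω => ?_)
  simp only
  rw [integral_inner (integrable_dir_sub hX _), medianGradient, inner_neg_right, neg_neg]

lemma norm_sub_sq_succ_le (h : IsMedianSGD P X γ F x z) (k : ℕ) (ω : Ω) :
    ‖z (k + 1) ω - m‖ ^ 2 ≤ ‖z k ω - m‖ ^ 2 +
      2 * γ k * ⟪z k ω - m, dir (x k ω - z k ω)⟫ + γ k ^ 2 := by
  have e : z (k + 1) ω - m = (z k ω - m) + γ k • dir (x k ω - z k ω) := by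
    rw [h.step]; abel
  rw [e, norm_add_sq_real, norm_smul, real_inner_smul_right, mul_pow, Real.norm_eq_abs, sq_abs]
  have := pow_le_one₀ (n := 2) (norm_nonneg _) (norm_dir_le_one (x k ω - z k ω))
  nlinarith [sq_nonneg (γ k)]

lemma integrable_stayInd_mul_sq (h : IsMedianSGD P X γ F x z) (A : ℝ) (k : ℕ) :
    Integrable (fun ω => stayInd z m A k ω * ‖z k ω - m‖ ^ 2) P := by
  refine Integrable.of_bound ((h.measurable_stayInd' A k).mul
    (((h.measurable_iter' k).sub_const m).norm.pow_const 2)).aestronglyMeasurable (A ^ 2)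
    (Filter.Eventually.of_forall fun ω => ?_)
  rw [Real.norm_eq_abs, abs_of_nonneg (mul_nonneg (stayInd_nonneg _ _ _) (sq_nonneg _))]
  exact stayInd_mul_sq_le A k ω

lemma integrable_stayInd_mul (h : IsMedianSGD P X γ F x z) {A : ℝ} (hA : 0 ≤ A) (k : ℕ) :
    Integrable (fun ω => stayInd z m A k ω * ‖z k ω - m‖) P := by
  refine Integrable.of_bound ((h.measurable_stayInd' A k).mul
    ((h.measurable_iter' k).sub_const m).norm).aestronglyMeasurable A
    (Filter.Eventually.of_forall fun ω => ?_)
  rw [Real.norm_eq_abs, abs_of_nonneg (mul_nonneg (stayInd_nonneg _ _ _) (norm_nonneg _))]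
  exact stayInd_mul_le hA k ω

lemma integrable_stayInd (h : IsMedianSGD P X γ F x z) (A : ℝ) (k : ℕ) :
    Integrable (stayInd z m A k) P :=
  Integrable.of_bound (h.measurable_stayInd' A k).aestronglyMeasurable 1
    (Filter.Eventually.of_forall fun ω => by
      rw [Real.norm_eq_abs, abs_of_nonneg (stayInd_nonneg _ _ _)]; exact stayInd_le_one A k ω)

/-- One step of the recursion for the truncated quadratic error. -/
lemma integral_stayInd_mul_succ_le [CompleteSpace H] (h : IsMedianSGD P X γ F x z)
    (hX : Measurable X) {A : ℝ} (hA : 0 ≤ A) {k : ℕ} (hγ : 0 ≤ γ k) {c : ℝ}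
    (hc : ∀ y, ‖y - m‖ ≤ A → c * ‖y - m‖ ^ 2 ≤ ⟪medianGradient P X y, y - m⟫) :
    Integrable (fun ω => stayInd z m A k ω * ‖z (k + 1) ω - m‖ ^ 2) P ∧
    ∫ ω, stayInd z m A k ω * ‖z (k + 1) ω - m‖ ^ 2 ∂P ≤
      (1 - 2 * c * γ k) * ∫ ω, stayInd z m A k ω * ‖z k ω - m‖ ^ 2 ∂P + γ k ^ 2 := by
  set Y : Ω → H := fun ω => stayInd z m A k ω • (z k ω - m) with hYdef
  have hY : Measurable[F k] Y := (h.measurable_stayInd A k).smul ((h.measurable_iter k).sub_const m)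
  have hYA : ∀ ω, ‖Y ω‖ ≤ A := fun ω => by
    rw [hYdef, norm_smul, Real.norm_eq_abs, abs_of_nonneg (stayInd_nonneg _ _ _)]
    exact stayInd_mul_le hA k ω
  have hi1 := h.integrable_stayInd_mul_sq (m := m) A k
  have hi2 := h.integrable_inner_dir hY (h.measurable_iter k) hYA
  have hle : ∀ ω, stayInd z m A k ω * ‖z (k + 1) ω - m‖ ^ 2 ≤
      stayInd z m A k ω * ‖z k ω - m‖ ^ 2 + 2 * γ k * ⟪Y ω, dir (x k ω - z k ω)⟫ + γ k ^ 2 := by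
    intro ω
    have h1 := mul_le_mul_of_nonneg_left (h.norm_sub_sq_succ_le (m := m) k ω)
      (stayInd_nonneg (z := z) (m := m) A k ω)
    have h2 := stayInd_le_one (z := z) (m := m) A k ω
    rw [hYdef, real_inner_smul_left]
    nlinarith [sq_nonneg (γ k)]
  have hi3 := (hi1.add (hi2.const_mul (2 * γ k))).add (integrable_const (γ k ^ 2))
  have hi4 : Integrable (fun ω => stayInd z m A k ω * ‖z (k + 1) ω - m‖ ^ 2) P := by
    refine hi3.mono' ((h.measurable_stayInd' A k).mul
      (((h.measurable_iter' (k + 1)).sub_const m).norm.pow_const 2)).aestronglyMeasurable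
      (Filter.Eventually.of_forall fun ω => ?_)
    rw [Real.norm_eq_abs, abs_of_nonneg (mul_nonneg (stayInd_nonneg _ _ _) (sq_nonneg _))]
    exact hle ω
  refine ⟨hi4, ?_⟩
  refine (integral_mono hi4 hi3 hle).trans ?_
  have e1 : ∫ ω, (stayInd z m A k ω * ‖z k ω - m‖ ^ 2 +
      2 * γ k * ⟪Y ω, dir (x k ω - z k ω)⟫ + γ k ^ 2) ∂P =
      ∫ ω, stayInd z m A k ω * ‖z k ω - m‖ ^ 2 ∂P +
        2 * γ k * ∫ ω, ⟪Y ω, dir (x k ω - z k ω)⟫ ∂P + γ k ^ 2 := by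
    rw [integral_add (hi1.fun_add (hi2.const_mul _)) (integrable_const _),
      integral_add hi1 (hi2.const_mul _), integral_const_mul]
    simp
  refine e1.le.trans ?_
  rw [h.integral_inner_dir hX hY (h.measurable_iter k) hYA]
  have hi5 : Integrable (fun ω => ⟪Y ω, medianGradient P X (z k ω)⟫) P := by
    refine Integrable.of_bound ((hY.mono (F.le k) le_rfl).inner
      ((measurable_medianGradient hX).comp (h.measurable_iter' k))).aestronglyMeasurable A
      (Filter.Eventually.of_forall fun ω => ?_)
    refine (norm_inner_le_norm _ _).trans ?_
    exact (mul_le_of_le_one_right (norm_nonneg _) (norm_medianGradient_le_one _)).trans (hYA ω)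
  have h6 : c * ∫ ω, stayInd z m A k ω * ‖z k ω - m‖ ^ 2 ∂P ≤
      ∫ ω, ⟪Y ω, medianGradient P X (z k ω)⟫ ∂P := by
    rw [← integral_const_mul]
    refine integral_mono (hi1.const_mul c) hi5 fun ω => ?_
    simp only [hYdef, real_inner_smul_left]
    by_cases hω : ω ∈ stay z m A k
    · rw [stayInd_of_mem hω, one_mul, one_mul, real_inner_comm]
      exact hc _ (hω k le_rfl)
    · simp [stayInd_of_notMem hω]
  nlinarith

lemma stayInd_succ_mul_le (A : ℝ) (k : ℕ) (ω : Ω) :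
    stayInd z m A (k + 1) ω * ‖z (k + 1) ω - m‖ ^ 2 ≤
      stayInd z m A k ω * ‖z (k + 1) ω - m‖ ^ 2 := by
  refine mul_le_mul_of_nonneg_right ?_ (sq_nonneg _)
  by_cases h : ω ∈ stay z m A (k + 1)
  · rw [stayInd_of_mem h, stayInd_of_mem fun j hj => h j (hj.trans k.le_succ)]
  · rw [stayInd_of_notMem h]; exact stayInd_nonneg _ _ _

/-- The potential freezes at `A²` on exit. An exit at time `k + 1` can only lower it, because there
`‖z (k + 1) - m‖` exceeds `A`. -/
lemma stayInd_succ_exit_le {A : ℝ} (hA : 0 ≤ A) (k : ℕ) (ω : Ω) :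
    stayInd z m A (k + 1) ω * ‖z (k + 1) ω - m‖ ^ 2 + A ^ 2 * (1 - stayInd z m A (k + 1) ω) ≤
      stayInd z m A k ω * ‖z (k + 1) ω - m‖ ^ 2 + A ^ 2 * (1 - stayInd z m A k ω) := by
  by_cases h : ω ∈ stay z m A (k + 1)
  · rw [stayInd_of_mem h, stayInd_of_mem fun j hj => h j (hj.trans k.le_succ)]
  · rw [stayInd_of_notMem h]
    by_cases h2 : ω ∈ stay z m A k
    · rw [stayInd_of_mem h2]
      have h3 : A < ‖z (k + 1) ω - m‖ := by
        by_contra! h4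
        refine h fun j hj => ?_
        rcases Nat.le_succ_iff.1 hj with h5 | h5
        · exact h2 j h5
        · rw [h5]; exact h4
      nlinarith
    · rw [stayInd_of_notMem h2]

/-- Maximal inequality: the iterates remain in a large ball with high probability. -/
lemma sq_mul_integral_exit_le [CompleteSpace H] (h : IsMedianSGD P X γ F x z)
    (hX : Measurable X) {A R : ℝ} (hA : 0 ≤ A) (hRA : R ≤ A) (hγ : ∀ k, 0 ≤ γ k)
    (hc : ∀ y, ‖y - m‖ ≤ A → 0 ≤ ⟪medianGradient P X y, y - m⟫)
    (hR : ∀ᵐ ω ∂P, ‖z 0 ω - m‖ ≤ R) (n : ℕ) :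
    A ^ 2 * ∫ ω, (1 - stayInd z m A n ω) ∂P ≤ R ^ 2 + ∑ k ∈ Finset.range n, γ k ^ 2 := by
  have hi : ∀ k, Integrable (fun ω => A ^ 2 * (1 - stayInd z m A k ω)) P := fun k =>
    ((integrable_const 1).sub (h.integrable_stayInd A k)).const_mul _
  have key : ∫ ω, (stayInd z m A n ω * ‖z n ω - m‖ ^ 2 + A ^ 2 * (1 - stayInd z m A n ω)) ∂P ≤
      R ^ 2 + ∑ k ∈ Finset.range n, γ k ^ 2 := by
    induction n with
    | zero =>
      have : ∫ ω, (stayInd z m A 0 ω * ‖z 0 ω - m‖ ^ 2 + A ^ 2 * (1 - stayInd z m A 0 ω)) ∂P ≤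
          ∫ _, R ^ 2 ∂P := by
        refine integral_mono_ae ((h.integrable_stayInd_mul_sq A 0).add (hi 0))
          (integrable_const _) ?_
        filter_upwards [hR] with ω hω
        have h0 : ω ∈ stay z m A 0 := fun j hj => by
          rw [Nat.le_zero.1 hj]; exact hω.trans hRA
        rw [stayInd_of_mem h0]
        have := pow_le_pow_left₀ (norm_nonneg _) hω 2
        linarith
      simpa using this
    | succ n ih =>
      -- With `c = 0` only monotonicity is used: the mean potential grows by at most `γ n ^ 2`.
      obtain ⟨hi1, hle⟩ := h.integral_stayInd_mul_succ_le hX hA (hγ n) (c := 0) (m := m)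
        (by simpa using hc)
      have h1 : ∫ ω, (stayInd z m A (n + 1) ω * ‖z (n + 1) ω - m‖ ^ 2 +
          A ^ 2 * (1 - stayInd z m A (n + 1) ω)) ∂P ≤
          ∫ ω, (stayInd z m A n ω * ‖z (n + 1) ω - m‖ ^ 2 +
          A ^ 2 * (1 - stayInd z m A n ω)) ∂P :=
        integral_mono ((h.integrable_stayInd_mul_sq A (n + 1)).add (hi (n + 1))) (hi1.add (hi n))
          (stayInd_succ_exit_le hA n)
      rw [integral_add hi1 (hi n)] at h1
      rw [integral_add (h.integrable_stayInd_mul_sq A n) (hi n)] at ih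
      rw [Finset.sum_range_succ]
      linarith
  rw [← integral_const_mul]
  refine le_trans (integral_mono (hi n) ((h.integrable_stayInd_mul_sq A n).add (hi n))
    fun ω => ?_) key
  have := mul_nonneg (stayInd_nonneg (z := z) (m := m) A n ω) (sq_nonneg ‖z n ω - m‖)
  simp only [Pi.add_apply]
  linarith

/-- The difference between the martingale increments of the gradient at the iterate and at `m`. -/
noncomputable def noiseDiff (P : Measure Ω) (X : Ω → H) (x z : ℕ → Ω → H) (m : H) (k : ℕ)
    (ω : Ω) : H :=
  dir (x k ω - z k ω) + medianGradient P X (z k ω) - dir (x k ω - m)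

lemma norm_noiseDiff_le (k : ℕ) (ω : Ω) : ‖noiseDiff P X x z m k ω‖ ≤ 3 := by
  refine (norm_sub_le _ _).trans ?_
  linarith [norm_add_le (dir (x k ω - z k ω)) (medianGradient P X (z k ω)),
    norm_dir_le_one (x k ω - z k ω), norm_dir_le_one (x k ω - m),
    norm_medianGradient_le_one (P := P) (X := X) (z k ω)]

lemma measurable_noiseDiff (h : IsMedianSGD P X γ F x z) (hX : Measurable X) (k : ℕ) :
    Measurable[F (k + 1)] (noiseDiff P X x z m k) := by
  have hz : Measurable[F (k + 1)] (z k) := (h.measurable_iter k).mono (F.mono k.le_succ) le_rfl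
  have hx := h.measurable_sample k
  exact ((measurable_dir.comp (hx.sub hz)).add ((measurable_medianGradient hX).comp hz)).sub
    (measurable_dir.comp (hx.sub_const m))

/-- The truncated sum of the differences of noises. -/
noncomputable def noiseSum (P : Measure Ω) (X : Ω → H) (x z : ℕ → Ω → H) (m : H) (A : ℝ) (n : ℕ)
    (ω : Ω) : H :=
  ∑ k ∈ Finset.range n, stayInd z m A k ω • noiseDiff P X x z m k ω

lemma measurable_noiseSum (h : IsMedianSGD P X γ F x z) (hX : Measurable X) (A : ℝ) (n : ℕ) :
    Measurable[F n] (noiseSum P X x z m A n) := by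
  refine Finset.measurable_sum _ fun k hk => ?_
  have hk' := Finset.mem_range.1 hk
  exact ((h.measurable_stayInd A k).mono (F.mono hk'.le) le_rfl).smul
    ((h.measurable_noiseDiff hX k).mono (F.mono hk') le_rfl)

lemma norm_stayInd_smul_le (A : ℝ) (k : ℕ) (ω : Ω) (y : H) :
    ‖stayInd z m A k ω • y‖ ≤ ‖y‖ := by
  rw [norm_smul, Real.norm_eq_abs, abs_of_nonneg (stayInd_nonneg _ _ _)]
  exact mul_le_of_le_one_left (norm_nonneg _) (stayInd_le_one _ _ _)

lemma norm_noiseSum_le (A : ℝ) (n : ℕ) (ω : Ω) : ‖noiseSum P X x z m A n ω‖ ≤ n * 3 := by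
  refine (norm_sum_le _ _).trans ?_
  refine (Finset.sum_le_card_nsmul _ _ 3 fun k _ =>
    (norm_stayInd_smul_le A k ω _).trans (norm_noiseDiff_le k ω)).trans ?_
  simp

lemma integral_inner_noiseDiff [CompleteSpace H] (h : IsMedianSGD P X γ F x z)
    (hX : Measurable X) (hm : medianGradient P X m = 0) {k : ℕ} {Y : Ω → H}
    (hY : Measurable[F k] Y) {B : ℝ} (hB : ∀ ω, ‖Y ω‖ ≤ B) :
    ∫ ω, ⟪Y ω, noiseDiff P X x z m k ω⟫ ∂P = 0 := by
  have h1 := h.integral_inner_dir hX hY (h.measurable_iter k) hB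
  have h2 := h.integral_inner_dir hX hY (measurable_const (a := m)) hB
  have hi1 := h.integrable_inner_dir hY (h.measurable_iter k) hB
  have hi2 := h.integrable_inner_dir hY (measurable_const (a := m)) hB
  have hi3 : Integrable (fun ω => ⟪Y ω, medianGradient P X (z k ω)⟫) P := by
    refine Integrable.of_bound ((hY.mono (F.le k) le_rfl).inner
      ((measurable_medianGradient hX).comp (h.measurable_iter' k))).aestronglyMeasurable B
      (Filter.Eventually.of_forall fun ω => ?_)
    refine (norm_inner_le_norm _ _).trans ?_
    exact (mul_le_of_le_one_right (norm_nonneg _) (norm_medianGradient_le_one _)).trans (hB ω)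
  simp only [noiseDiff, inner_add_right, inner_sub_right]
  rw [integral_sub (hi1.fun_add hi3) hi2, integral_add hi1 hi3, h1, h2, hm]
  simp

/-- The noise difference is the gradient at `z k` minus a difference of directions. The former is at
most a multiple of `‖z k - m‖` by the first inverse moment; the latter is so in mean square, by the
second. -/
lemma exists_integral_noiseDiff_sq_le (h : IsMedianSGD P X γ F x z)
    (hX : Measurable X) (hA2 : BoundedInverseMoment P X 1) (hA3 : BoundedInverseMoment P X 2)
    (hm : medianGradient P X m = 0) :
    ∃ C : ℝ, 0 ≤ C ∧ ∀ A k, ∫ ω, stayInd z m A k ω * ‖noiseDiff P X x z m k ω‖ ^ 2 ∂P ≤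
      C * ∫ ω, stayInd z m A k ω * ‖z k ω - m‖ ^ 2 ∂P := by
  obtain ⟨C₁, hC₁, h1⟩ := norm_medianGradient_sub_le_mul (P := P) hX hA2 m
  obtain ⟨C₂, hC₂, h2⟩ := integral_norm_dir_sub_dir_sq_le (P := P) hX hA3 m
  refine ⟨2 * C₂ + 2 * C₁ ^ 2, by positivity, fun A k => ?_⟩
  set g : ℝ × H → H → ℝ := fun p y => p.1 * ‖dir (y - m) - dir (y - p.2)‖ ^ 2 with hg
  have hgm : Measurable (Function.uncurry g) := by
    refine (measurable_fst.comp measurable_fst).mul (Measurable.pow_const (Measurable.norm ?_) 2)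
    exact (measurable_dir.comp (measurable_snd.sub_const m)).sub
      (measurable_dir.comp (measurable_snd.sub (measurable_snd.comp measurable_fst)))
  have hW := (h.measurable_stayInd (m := m) A k).prodMk (h.measurable_iter k)
  have hgi : Integrable (fun ω => g (stayInd z m A k ω, z k ω) (x k ω)) P := by
    refine Integrable.of_bound (hgm.comp ((hW.mono (F.le k) le_rfl).prodMk
      (h.measurable_sample' k))).aestronglyMeasurable (2 ^ 2)
      (Filter.Eventually.of_forall fun ω => ?_)
    rw [Real.norm_eq_abs, abs_of_nonneg (mul_nonneg (stayInd_nonneg _ _ _) (sq_nonneg _))]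
    refine (mul_le_of_le_one_left (sq_nonneg _) (stayInd_le_one _ _ _)).trans ?_
    exact pow_le_pow_left₀ (norm_nonneg _) (norm_dir_sub_dir_le_two _ _) 2
  obtain ⟨hi1, he⟩ := h.integral_sample hX hW hgm hgi
  have hi2 := h.integrable_stayInd_mul_sq (m := m) A k
  have h3 : ∫ ω, g (stayInd z m A k ω, z k ω) (x k ω) ∂P ≤
      C₂ * ∫ ω, stayInd z m A k ω * ‖z k ω - m‖ ^ 2 ∂P := by
    rw [he, ← integral_const_mul]
    refine integral_mono hi1 (hi2.const_mul _) fun ω => ?_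
    simp only [hg, integral_const_mul]
    nlinarith [h2 (z k ω), stayInd_nonneg (z := z) (m := m) A k ω]
  have h4 : ∫ ω, stayInd z m A k ω * ‖noiseDiff P X x z m k ω‖ ^ 2 ∂P ≤
      ∫ ω, (2 * g (stayInd z m A k ω, z k ω) (x k ω) +
        2 * C₁ ^ 2 * (stayInd z m A k ω * ‖z k ω - m‖ ^ 2)) ∂P := by
    refine integral_mono_of_nonneg (Filter.Eventually.of_forall fun ω =>
      mul_nonneg (stayInd_nonneg _ _ _) (sq_nonneg _))
      ((hgi.const_mul 2).add (hi2.const_mul _)) (Filter.Eventually.of_forall fun ω => ?_)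
    have h5 : ‖noiseDiff P X x z m k ω‖ ≤
        ‖dir (x k ω - m) - dir (x k ω - z k ω)‖ + C₁ * ‖z k ω - m‖ := by
      have e : noiseDiff P X x z m k ω = medianGradient P X (z k ω) -
          (dir (x k ω - m) - dir (x k ω - z k ω)) := by
        rw [noiseDiff]; abel
      rw [e]
      have h6 := h1 (z k ω)
      rw [hm, sub_zero] at h6
      linarith [norm_sub_le (medianGradient P X (z k ω))
        (dir (x k ω - m) - dir (x k ω - z k ω))]
    have h7 := pow_le_pow_left₀ (norm_nonneg _) h5 2
    have h8 : (‖dir (x k ω - m) - dir (x k ω - z k ω)‖ + C₁ * ‖z k ω - m‖) ^ 2 ≤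
        2 * ‖dir (x k ω - m) - dir (x k ω - z k ω)‖ ^ 2 + 2 * (C₁ * ‖z k ω - m‖) ^ 2 := by
      nlinarith [sq_nonneg (‖dir (x k ω - m) - dir (x k ω - z k ω)‖ - C₁ * ‖z k ω - m‖)]
    simp only [hg]
    have h9 := mul_le_mul_of_nonneg_left (h7.trans h8) (stayInd_nonneg (z := z) (m := m) A k ω)
    rw [mul_pow] at h9
    linarith
  rw [integral_add (hgi.const_mul 2) (hi2.const_mul _), integral_const_mul,
    integral_const_mul] at h4
  linarith

/-- Orthogonality of the martingale increments. -/
lemma exists_integral_noiseSum_sq_le [CompleteSpace H] (h : IsMedianSGD P X γ F x z)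
    (hX : Measurable X) (hA2 : BoundedInverseMoment P X 1) (hA3 : BoundedInverseMoment P X 2)
    (hm : medianGradient P X m = 0) :
    ∃ C : ℝ, 0 ≤ C ∧ ∀ A n, ∫ ω, ‖noiseSum P X x z m A n ω‖ ^ 2 ∂P ≤
      C * ∑ k ∈ Finset.range n, ∫ ω, stayInd z m A k ω * ‖z k ω - m‖ ^ 2 ∂P := by
  obtain ⟨C, hC, hle⟩ := h.exists_integral_noiseDiff_sq_le hX hA2 hA3 hm
  refine ⟨C, hC, fun A n => ?_⟩
  induction n with
  | zero => simp [noiseSum]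
  | succ n ih =>
    have hS := h.measurable_noiseSum (m := m) hX A n
    have hS' : Measurable (noiseSum P X x z m A n) := hS.mono (F.le n) le_rfl
    have hD' : Measurable (noiseDiff P X x z m n) :=
      (h.measurable_noiseDiff hX n).mono (F.le _) le_rfl
    have hI' := h.measurable_stayInd' (m := m) A n
    have hYm : Measurable[F n] fun ω => stayInd z m A n ω • noiseSum P X x z m A n ω :=
      (h.measurable_stayInd A n).smul hS
    have hYb : ∀ ω, ‖stayInd z m A n ω • noiseSum P X x z m A n ω‖ ≤ n * 3 := fun ω =>
      (norm_stayInd_smul_le A n ω _).trans (norm_noiseSum_le A n ω)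
    have h0 := h.integral_inner_noiseDiff hX hm hYm hYb
    have hi1 : Integrable (fun ω => ‖noiseSum P X x z m A n ω‖ ^ 2) P :=
      Integrable.of_bound (hS'.norm.pow_const 2).aestronglyMeasurable ((n * 3) ^ 2)
        (Filter.Eventually.of_forall fun ω => by
          rw [Real.norm_eq_abs, abs_of_nonneg (sq_nonneg _)]
          exact pow_le_pow_left₀ (norm_nonneg _) (norm_noiseSum_le A n ω) 2)
    have hi2 : Integrable (fun ω => ⟪stayInd z m A n ω • noiseSum P X x z m A n ω,
        noiseDiff P X x z m n ω⟫) P :=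
      Integrable.of_bound ((hI'.smul hS').inner hD').aestronglyMeasurable (n * 3 * 3)
        (Filter.Eventually.of_forall fun ω => (norm_inner_le_norm _ _).trans
          (mul_le_mul (hYb ω) (norm_noiseDiff_le n ω) (norm_nonneg _) (by positivity)))
    have hi3 : Integrable (fun ω => stayInd z m A n ω * ‖noiseDiff P X x z m n ω‖ ^ 2) P :=
      Integrable.of_bound (hI'.mul (hD'.norm.pow_const 2)).aestronglyMeasurable (3 ^ 2)
        (Filter.Eventually.of_forall fun ω => by
          rw [Real.norm_eq_abs, abs_of_nonneg (mul_nonneg (stayInd_nonneg _ _ _) (sq_nonneg _))]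
          exact (mul_le_of_le_one_left (sq_nonneg _) (stayInd_le_one _ _ _)).trans
            (pow_le_pow_left₀ (norm_nonneg _) (norm_noiseDiff_le n ω) 2))
    have e : ∀ ω, ‖noiseSum P X x z m A (n + 1) ω‖ ^ 2 = ‖noiseSum P X x z m A n ω‖ ^ 2 +
        2 * ⟪stayInd z m A n ω • noiseSum P X x z m A n ω, noiseDiff P X x z m n ω⟫ +
        stayInd z m A n ω * ‖noiseDiff P X x z m n ω‖ ^ 2 := by
      intro ω
      have : noiseSum P X x z m A (n + 1) ω = noiseSum P X x z m A n ω +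
          stayInd z m A n ω • noiseDiff P X x z m n ω := Finset.sum_range_succ _ _
      rw [this, norm_add_sq_real, norm_smul, mul_pow, Real.norm_eq_abs, sq_abs, stayInd_sq,
        real_inner_smul_left, real_inner_smul_right]
    simp only [e]
    rw [integral_add (hi1.fun_add (hi2.const_mul 2)) hi3, integral_add hi1 (hi2.const_mul 2),
      integral_const_mul, h0, Finset.sum_range_succ, mul_add]
    linarith [hle A n]

/-- The exponential moments of a sum of independent centred unit vectors. -/
lemma integral_cosh_norm_sum_le [CompleteSpace H] (h : IsMedianSGD P X γ F x z)
    (hX : Measurable X) (hne : ∀ᵐ ω ∂P, X ω ≠ m) (hm : medianGradient P X m = 0) {l : ℝ}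
    (hl : 0 ≤ l) (n : ℕ) :
    Integrable (fun ω => Real.cosh (l * ‖∑ k ∈ Finset.range n, dir (x k ω - m)‖)) P ∧
    ∫ ω, Real.cosh (l * ‖∑ k ∈ Finset.range n, dir (x k ω - m)‖) ∂P ≤ Real.cosh l ^ n := by
  set S : ℕ → Ω → H := fun n ω => ∑ k ∈ Finset.range n, dir (x k ω - m) with hSdef
  have hS : ∀ n, Measurable[F n] (S n) := fun n =>
    Finset.measurable_sum _ fun k hk => measurable_dir.comp
      (((h.measurable_sample k).mono (F.mono (Finset.mem_range.1 hk)) le_rfl).sub_const m)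
  have hSb : ∀ n ω, ‖S n ω‖ ≤ n := fun n ω => by
    refine (norm_sum_le _ _).trans ?_
    refine (Finset.sum_le_card_nsmul _ _ 1 fun k _ => norm_dir_le_one _).trans ?_
    simp
  have hi : ∀ n, Integrable (fun ω => Real.cosh (l * ‖S n ω‖)) P := fun n => by
    refine Integrable.of_bound (Real.measurable_cosh.comp
      (((hS n).mono (F.le n) le_rfl).norm.const_mul l)).aestronglyMeasurable (Real.cosh (l * n))
      (Filter.Eventually.of_forall fun ω => ?_)
    rw [Real.norm_eq_abs, abs_of_pos (Real.cosh_pos _), Real.cosh_le_cosh,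
      abs_of_nonneg (by positivity), abs_of_nonneg (by positivity)]
    exact mul_le_mul_of_nonneg_left (hSb n ω) hl
  refine ⟨hi n, ?_⟩
  change ∫ ω, Real.cosh (l * ‖S n ω‖) ∂P ≤ _
  induction n with
  | zero => simp [hSdef]
  | succ n ih =>
    -- This bounded vector of the past carries the linear term of `cosh_norm_add_le`; paired with
    -- the centred fresh direction, it integrates to zero.
    set Y : Ω → H := fun ω => Real.sinh (l * ‖S n ω‖) • dir (S n ω) with hYdef
    have hY : Measurable[F n] Y :=
      (Real.measurable_sinh.comp ((measurable_norm.comp (hS n)).const_mul l)).smul (measurable_dir.comp (hS n))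
    have hYb : ∀ ω, ‖Y ω‖ ≤ Real.sinh (l * n) := fun ω => by
      have h1 : 0 ≤ Real.sinh (l * ‖S n ω‖) := Real.sinh_nonneg_iff.2 (by positivity)
      rw [hYdef, norm_smul, Real.norm_eq_abs, abs_of_nonneg h1]
      refine (mul_le_of_le_one_right h1 (norm_dir_le_one _)).trans ?_
      exact Real.sinh_le_sinh.2 (mul_le_mul_of_nonneg_left (hSb n ω) hl)
    have h0 := h.integral_inner_dir hX hY (measurable_const (a := m)) hYb
    simp only [hm, inner_zero_right, integral_zero, neg_zero] at h0
    have hi2 := h.integrable_inner_dir hY (measurable_const (a := m)) hYb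
    have hxm : ∀ᵐ ω ∂P, x n ω ≠ m :=
      (h.ident_sample n).symm.ae_mem_snd (t := {m}ᶜ) (measurableSet_singleton m).compl hne
    have h2 : ∫ ω, Real.cosh (l * ‖S (n + 1) ω‖) ∂P ≤
        ∫ ω, (Real.cosh l * Real.cosh (l * ‖S n ω‖) +
          Real.sinh l * ⟪Y ω, dir (x n ω - m)⟫) ∂P := by
      refine integral_mono_ae (hi (n + 1)) (((hi n).const_mul _).add (hi2.const_mul _)) ?_
      filter_upwards [hxm] with ω hω
      have e : S (n + 1) ω = S n ω + dir (x n ω - m) := Finset.sum_range_succ _ _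
      have h3 := cosh_norm_add_le l (S n ω) (norm_dir (sub_ne_zero.2 hω))
      rw [e, hYdef, real_inner_smul_left]
      linarith
    rw [integral_add ((hi n).const_mul _) (hi2.const_mul _), integral_const_mul,
      integral_const_mul, h0, mul_zero, add_zero] at h2
    rw [pow_succ, mul_comm]
    exact h2.trans (mul_le_mul_of_nonneg_left ih (Real.cosh_pos _).le)

/-- Chernoff's bound for `cosh` at `l = y / √n`, with `cosh l ≤ exp (l² / 2)`. The prefactor 2 comes
from `cosh (y²) ≥ exp (y²) / 2`. -/
lemma measureReal_norm_sum_ge_le [CompleteSpace H] (h : IsMedianSGD P X γ F x z)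
    (hX : Measurable X) (hne : ∀ᵐ ω ∂P, X ω ≠ m) (hm : medianGradient P X m = 0) {y : ℝ}
    (hy : 0 ≤ y) {n : ℕ} (hn : n ≠ 0) :
    P.real {ω | y * √n ≤ ‖∑ k ∈ Finset.range n, dir (x k ω - m)‖} ≤
      2 * Real.exp (-(y ^ 2 / 2)) := by
  have hn' : (0 : ℝ) < n := by positivity
  have hs : 0 < √(n : ℝ) := Real.sqrt_pos.2 hn'
  have hsq : √(n : ℝ) ^ 2 = n := Real.sq_sqrt hn'.le
  set l := y / √(n : ℝ) with hl
  have hl0 : 0 ≤ l := by positivity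
  obtain ⟨hi, hle⟩ := h.integral_cosh_norm_sum_le hX hne hm hl0 n
  have h1 := mul_meas_ge_le_integral_of_nonneg
    (Filter.Eventually.of_forall fun ω => (Real.cosh_pos _).le) hi (Real.cosh (y ^ 2))
  have h2 : {ω | y * √n ≤ ‖∑ k ∈ Finset.range n, dir (x k ω - m)‖} ⊆
      {ω | Real.cosh (y ^ 2) ≤ Real.cosh (l * ‖∑ k ∈ Finset.range n, dir (x k ω - m)‖)} := by
    intro ω hω
    simp only [Set.mem_ofPred_eq] at hω ⊢
    rw [Real.cosh_le_cosh, abs_of_nonneg (by positivity), abs_of_nonneg (by positivity)]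
    have e : y ^ 2 = l * (y * √n) := by rw [hl]; field_simp
    rw [e]
    exact mul_le_mul_of_nonneg_left hω hl0
  have h3 := measureReal_mono (μ := P) h2
  have h4 : Real.cosh l ^ n ≤ Real.exp (y ^ 2 / 2) := by
    refine (pow_le_pow_left₀ (Real.cosh_pos _).le (Real.cosh_le_exp_half_sq l) n).trans_eq ?_
    rw [← Real.exp_nat_mul]
    congr 1
    rw [hl, div_pow, hsq]; field_simp
  have h5 : Real.exp (y ^ 2) / 2 ≤ Real.cosh (y ^ 2) := by
    rw [Real.cosh_eq]
    linarith [Real.exp_pos (-y ^ 2)]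
  have h6 : Real.exp (y ^ 2) / 2 *
      P.real {ω | y * √n ≤ ‖∑ k ∈ Finset.range n, dir (x k ω - m)‖} ≤ Real.exp (y ^ 2 / 2) :=
    (mul_le_mul h5 h3 measureReal_nonneg (Real.cosh_pos _).le).trans (h1.trans (hle.trans h4))
  have h7 : Real.exp (y ^ 2 / 2) = Real.exp (y ^ 2) * Real.exp (-(y ^ 2 / 2)) := by
    rw [← Real.exp_add]; congr 1; ring
  rw [h7] at h6
  have h8 := Real.exp_pos (y ^ 2)
  refine le_of_mul_le_mul_left ?_ h8
  linarith

end IsMedianSGD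

end Algorithm

/-! ### Power sums and the recursion of the quadratic error. -/

section PowerEstimates

lemma add_one_div_add_two_le_rpow {s : ℝ} (hs1 : s ≤ 1) (k : ℕ) :
    ((k : ℝ) + 1) / (k + 2) ≤ (((k : ℝ) + 1) / (k + 2)) ^ s := by
  have h0 : (0 : ℝ) < (k + 1) / (k + 2) := by positivity
  have h1 : ((k : ℝ) + 1) / (k + 2) ≤ 1 := by rw [div_le_one (by positivity)]; linarith
  conv_lhs => rw [← Real.rpow_one (((k : ℝ) + 1) / (k + 2))]
  exact Real.rpow_le_rpow_of_exponent_ge h0 h1 hs1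

lemma rpow_succ_sub_rpow_le {s : ℝ} (hs1 : s ≤ 1) (k : ℕ) :
    ((k : ℝ) + 2) ^ s - ((k : ℝ) + 1) ^ s ≤ ((k : ℝ) + 2) ^ (s - 1) := by
  have h2 : (0 : ℝ) < k + 2 := by positivity
  have h := add_one_div_add_two_le_rpow hs1 k
  rw [Real.div_rpow (by positivity) h2.le, div_le_div_iff₀ h2 (by positivity)] at h
  rw [Real.rpow_sub_one h2.ne', le_div_iff₀ h2]
  nlinarith

/-- The target rate loses at most a factor `1 - 1 / (k + 1)` per step, which is negligible against a
contraction of order `k ^ (-α)` with `α < 1`. -/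
lemma mul_one_sub_inv_le_rpow_neg_succ {s : ℝ} (hs1 : s ≤ 1) (k : ℕ) :
    ((k : ℝ) + 1) ^ (-s) * (1 - 1 / ((k : ℝ) + 1)) ≤ ((k : ℝ) + 2) ^ (-s) := by
  have h1 : (0 : ℝ) < k + 1 := by positivity
  have h2 : (0 : ℝ) < k + 2 := by positivity
  have h := add_one_div_add_two_le_rpow hs1 k
  rw [Real.div_rpow h1.le h2.le] at h
  rw [Real.rpow_neg h1.le, Real.rpow_neg h2.le]
  have h3 : 1 - 1 / ((k : ℝ) + 1) ≤ ((k : ℝ) + 1) / (k + 2) := by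
    rw [one_sub_div h1.ne', div_le_div_iff₀ h1 h2]
    nlinarith
  refine (mul_le_mul_of_nonneg_left (h3.trans h) (by positivity)).trans_eq ?_
  have : (0 : ℝ) < ((k : ℝ) + 1) ^ s := by positivity
  field_simp

/-- Discrete integral comparison: Bernoulli's inequality for the exponent `1 - s` bounds each term
by an increment of the right side. -/
lemma sum_rpow_neg_le {s : ℝ} (hs0 : 0 < s) (hs1 : s < 1) (n : ℕ) :
    ∑ k ∈ Finset.range n, ((k : ℝ) + 1) ^ (-s) ≤ (n : ℝ) ^ (1 - s) / (1 - s) := by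
  have hs : 0 < 1 - s := by linarith
  induction n with
  | zero => simp [Real.zero_rpow hs.ne']
  | succ n ih =>
    rw [Finset.sum_range_succ]
    have h1 : (0 : ℝ) < n + 1 := by positivity
    have h2 := rpow_one_add_le_one_add_mul_self (s := -(1 / ((n : ℝ) + 1)))
      (by rw [neg_le_neg_iff, div_le_one h1]; linarith [n.cast_nonneg (α := ℝ)]) hs.le
      (by linarith : 1 - s ≤ 1)
    have h3 : 1 + -(1 / ((n : ℝ) + 1)) = n / (n + 1) := by field_simp; ring
    rw [h3, Real.div_rpow n.cast_nonneg h1.le, div_le_iff₀ (by positivity)] at h2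
    have h4 : ((n : ℝ) + 1) ^ (-s) = ((n : ℝ) + 1) ^ (1 - s) / (n + 1) := by
      rw [← Real.rpow_sub_one h1.ne']; congr 1; ring
    have h5 : (n : ℝ) ^ (1 - s) + (1 - s) * ((n : ℝ) + 1) ^ (-s) ≤ ((n : ℝ) + 1) ^ (1 - s) := by
      rw [h4]
      refine (add_le_add_left h2 _).trans_eq ?_
      field_simp; ring
    push_cast
    refine (add_le_add_left ih _).trans ?_
    rw [div_add' _ _ _ hs.ne']
    gcongr
    linarith

/-- The rate of convergence given by the recursion of the quadratic error. -/
lemma exists_le_rpow_of_recursion {v : ℕ → ℝ} {B b c α : ℝ} (hB : ∀ k, v k ≤ B) (hB0 : 0 ≤ B)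
    (hb : 0 < b) (hc : 0 < c) (hα0 : 0 < α) (hα1 : α < 1)
    (hrec : ∀ k : ℕ, v (k + 1) ≤
      (1 - 2 * b * (c * ((k : ℝ) + 1) ^ (-α))) * v k + (c * ((k : ℝ) + 1) ^ (-α)) ^ 2) :
    ∃ K : ℝ, 0 ≤ K ∧ ∀ k : ℕ, v k ≤ K * ((k : ℝ) + 1) ^ (-α) := by
  have htop : Filter.Tendsto (fun k : ℕ => (k : ℝ) + 1) Filter.atTop Filter.atTop :=
    Filter.tendsto_atTop_add_const_right _ _ tendsto_natCast_atTop_atTop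
  have ht1 := ((tendsto_rpow_neg_atTop (y := 1 - α) (by linarith)).comp htop).eventually_le_const
    (u := b * c) (by positivity)
  have ht2 := ((tendsto_rpow_neg_atTop hα0).comp htop).eventually_le_const
    (u := 1 / (2 * b * c)) (by positivity)
  obtain ⟨N, hN⟩ := Filter.eventually_atTop.1 (ht1.and ht2)
  -- The first entry lets half of the contraction absorb the term `γ²`; the second covers the
  -- indices up to `N`.
  set K := max (c / b) (B * ((N : ℝ) + 1) ^ α) with hK
  have hK0 : 0 ≤ K := le_max_of_le_left (by positivity)
  refine ⟨K, hK0, fun k => ?_⟩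
  rcases le_total k N with hk | hk
  · have h1 : (0 : ℝ) < ((k : ℝ) + 1) ^ α := by positivity
    rw [Real.rpow_neg (by positivity), ← div_eq_mul_inv, le_div_iff₀ h1]
    refine le_trans ?_ (le_max_right _ _)
    have h2 : ((k : ℝ) + 1) ^ α ≤ ((N : ℝ) + 1) ^ α := by gcongr
    exact (mul_le_mul_of_nonneg_right (hB k) h1.le).trans (mul_le_mul_of_nonneg_left h2 hB0)
  · induction k, hk using Nat.le_induction with
    | base =>
      have h1 : (0 : ℝ) < ((N : ℝ) + 1) ^ α := by positivity
      rw [Real.rpow_neg (by positivity), ← div_eq_mul_inv, le_div_iff₀ h1]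
      exact (mul_le_mul_of_nonneg_right (hB N) h1.le).trans (le_max_right _ _)
    | succ k hk ih =>
      obtain ⟨h1, h2⟩ := hN k hk
      have hk1 : (0 : ℝ) < (k : ℝ) + 1 := by positivity
      simp only [Function.comp_apply] at h1 h2
      set p := ((k : ℝ) + 1) ^ (-α) with hp
      have hp0 : 0 < p := by positivity
      have h3 : 1 / ((k : ℝ) + 1) ≤ b * c * p := by
        have e : 1 / ((k : ℝ) + 1) = ((k : ℝ) + 1) ^ (-(1 - α)) * p := by
          rw [hp, ← Real.rpow_add hk1, one_div, ← Real.rpow_neg_one]; congr 1; ring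
        rw [e]; gcongr
      have h4 := mul_one_sub_inv_le_rpow_neg_succ hα1.le k
      rw [← hp] at h4
      have h5 : 0 ≤ 1 - 2 * b * (c * p) := by
        rw [le_div_iff₀ (by positivity)] at h2
        linarith
      have h6 : c ≤ K * b := by
        rw [← div_le_iff₀ hb]; exact le_max_left _ _
      have h7 := mul_le_mul_of_nonneg_left ih h5
      have h8 : p * (1 - b * c * p) ≤ ((k : ℝ) + 2) ^ (-α) :=
        le_trans (by gcongr) h4
      have h9 := mul_le_mul_of_nonneg_left h8 hK0
      have h10 := mul_le_mul_of_nonneg_right h6 (by positivity : 0 ≤ c * p ^ 2)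
      have e : ((k + 1 : ℕ) : ℝ) + 1 = (k : ℝ) + 2 := by push_cast; ring
      rw [e]
      refine (hrec k).trans ?_
      nlinarith

end PowerEstimates

/-! ### Linearization by summation by parts, and the mean of the remainder. -/

section Assembly

variable {H : Type*} [NormedAddCommGroup H] [InnerProductSpace ℝ H] [MeasurableSpace H]
  {Ω : Type*} {mΩ : MeasurableSpace Ω} [BorelSpace H] [SecondCountableTopology H]
  {P : Measure Ω} [IsProbabilityMeasure P] {X : Ω → H} {γ : ℕ → ℝ} {F : Filtration ℕ mΩ}
  {x z : ℕ → Ω → H} {m : H}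

/-- Summation by parts. -/
lemma sum_smul_sub_succ {E : Type*} [AddCommGroup E] [Module ℝ E] (g : ℕ → ℝ) (T : ℕ → E)
    (n : ℕ) : ∑ k ∈ Finset.range n, g k • (T k - T (k + 1)) =
      g 0 • T 0 - g n • T n + ∑ k ∈ Finset.range n, (g (k + 1) - g k) • T (k + 1) := by
  induction n with
  | zero => simp
  | succ n ih =>
    rw [Finset.sum_range_succ, ih, Finset.sum_range_succ]
    module

namespace IsMedianSGD

/-- The truncated error terms of the averaged algorithm. -/
noncomputable def remainder (P : Measure Ω) (X : Ω → H) (γ : ℕ → ℝ) (x z : ℕ → Ω → H) (m : H)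
    (A C : ℝ) (n : ℕ) (ω : Ω) : ℝ :=
  (γ 0)⁻¹ * A + (γ n)⁻¹ * (stayInd z m A n ω * ‖z n ω - m‖) +
    ∑ k ∈ Finset.range n, ((γ (k + 1))⁻¹ - (γ k)⁻¹) *
      (stayInd z m A (k + 1) ω * ‖z (k + 1) ω - m‖) +
    ‖noiseSum P X x z m A n ω‖ +
    C * ∑ k ∈ Finset.range n, stayInd z m A k ω * ‖z k ω - m‖ ^ 2

/-- The linearized algorithm is a sum of independent unit vectors up to a remainder. -/
lemma norm_hessian_sum_le (h : IsMedianSGD P X γ F x z) {L : H →L[ℝ] H} {A C : ℝ}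
    (hγ : ∀ k, 0 < γ k) (hγ' : Antitone γ)
    (hL : ∀ y, ‖medianGradient P X y - L (y - m)‖ ≤ C * ‖y - m‖ ^ 2) {n : ℕ} {ω : Ω}
    (hω : ω ∈ stay z m A n) :
    ‖L (∑ k ∈ Finset.range n, (z k ω - m))‖ ≤
      ‖∑ k ∈ Finset.range n, dir (x k ω - m)‖ + remainder P X γ x z m A C n ω := by
  have hst : ∀ k ≤ n, ω ∈ stay z m A k := fun k hk j hj => hω j (hj.trans hk)
  -- An exact identity: the gradient at `z k` cancels between the noise difference and the Taylor
  -- error.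
  have hstep : ∀ k, L (z k ω - m) = (γ k)⁻¹ • ((z k ω - m) - (z (k + 1) ω - m)) +
      dir (x k ω - m) + noiseDiff P X x z m k ω -
      (medianGradient P X (z k ω) - L (z k ω - m)) := by
    intro k
    have e : (γ k)⁻¹ • ((z k ω - m) - (z (k + 1) ω - m)) = -dir (x k ω - z k ω) := by
      rw [h.step]
      have : z k ω - m - (z k ω + γ k • dir (x k ω - z k ω) - m) =
        -(γ k • dir (x k ω - z k ω)) := by abel
      rw [this, smul_neg, inv_smul_smul₀ (hγ k).ne']
    rw [e, noiseDiff]; abel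
  rw [map_sum, Finset.sum_congr rfl fun k _ => hstep k, Finset.sum_sub_distrib,
    Finset.sum_add_distrib, Finset.sum_add_distrib,
    sum_smul_sub_succ (fun k => (γ k)⁻¹) (fun k => z k ω - m)]
  have h1 : ‖(γ 0)⁻¹ • (z 0 ω - m)‖ ≤ (γ 0)⁻¹ * A := by
    rw [norm_smul, Real.norm_eq_abs, abs_of_pos (inv_pos.2 (hγ 0))]
    exact mul_le_mul_of_nonneg_left (hω 0 n.zero_le) (inv_pos.2 (hγ 0)).le
  have h2 : ‖(γ n)⁻¹ • (z n ω - m)‖ = (γ n)⁻¹ * (stayInd z m A n ω * ‖z n ω - m‖) := by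
    rw [norm_smul, Real.norm_eq_abs, abs_of_pos (inv_pos.2 (hγ n)), stayInd_of_mem hω, one_mul]
  have h3 : ‖∑ k ∈ Finset.range n, ((γ (k + 1))⁻¹ - (γ k)⁻¹) • (z (k + 1) ω - m)‖ ≤
      ∑ k ∈ Finset.range n, ((γ (k + 1))⁻¹ - (γ k)⁻¹) *
        (stayInd z m A (k + 1) ω * ‖z (k + 1) ω - m‖) := by
    refine (norm_sum_le _ _).trans (Finset.sum_le_sum fun k hk => ?_)
    have : 0 ≤ (γ (k + 1))⁻¹ - (γ k)⁻¹ :=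
      sub_nonneg.2 (inv_anti₀ (hγ _) (hγ' k.le_succ))
    rw [norm_smul, Real.norm_eq_abs, abs_of_nonneg this,
      stayInd_of_mem (hst _ (Finset.mem_range.1 hk)), one_mul]
  have h4 : ∑ k ∈ Finset.range n, noiseDiff P X x z m k ω = noiseSum P X x z m A n ω :=
    Finset.sum_congr rfl fun k hk => by
      rw [stayInd_of_mem (hst _ (Finset.mem_range.1 hk).le), one_smul]
  have h5 : ‖∑ k ∈ Finset.range n, (medianGradient P X (z k ω) - L (z k ω - m))‖ ≤
      C * ∑ k ∈ Finset.range n, stayInd z m A k ω * ‖z k ω - m‖ ^ 2 := by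
    rw [Finset.mul_sum]
    refine (norm_sum_le _ _).trans (Finset.sum_le_sum fun k hk => ?_)
    rw [stayInd_of_mem (hst _ (Finset.mem_range.1 hk).le), one_mul]
    exact hL _
  rw [h4]
  refine (norm_sub_le _ _).trans ?_
  refine (add_le_add_left (norm_add₃_le) _).trans ?_
  refine (add_le_add_left (add_le_add_left (add_le_add_left (norm_add_le _ _) _) _) _).trans ?_
  refine (add_le_add_left (add_le_add_left (add_le_add_left (add_le_add_left
    (norm_sub_le _ _) _) _) _) _).trans ?_
  rw [remainder]
  linarith

/-- The mean of the remainder is of smaller order than `√n`. -/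
lemma exists_integral_remainder_le [CompleteSpace H] {c α : ℝ}
    (h : IsMedianSGD P X (fun k => c * ((k : ℝ) + 1) ^ (-α)) F x z) (hX : Measurable X)
    (hA1 : NotConcentratedOnLine P X) (hA2 : BoundedInverseMoment P X 1)
    (hA3 : BoundedInverseMoment P X 2) (hm : IsGeometricMedian P X m)
    (hc : 0 < c) (hα0 : 0 < α) (hα1 : α < 1) {A C : ℝ} (hA : 0 < A) (hC : 0 ≤ C) :
    ∃ D : ℝ, 0 ≤ D ∧ ∀ n : ℕ,
      Integrable (remainder P X (fun k => c * ((k : ℝ) + 1) ^ (-α)) x z m A C n) P ∧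
      ∫ ω, remainder P X (fun k => c * ((k : ℝ) + 1) ^ (-α)) x z m A C n ω ∂P ≤
        D * (((n : ℝ) + 1) ^ (α / 2) + ((n : ℝ) + 1) ^ (1 - α)) := by
  set γ : ℕ → ℝ := fun k => c * ((k : ℝ) + 1) ^ (-α) with hγdef
  have hγinv : ∀ k, (γ k)⁻¹ = c⁻¹ * ((k : ℝ) + 1) ^ α := fun k => by
    rw [hγdef]
    simp only
    rw [mul_inv, Real.rpow_neg (by positivity), inv_inv]
  obtain ⟨b, hb, hcoer⟩ := exists_le_inner_medianGradient hX hA1 hA2 hm hA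
  have hm0 := hm.medianGradient_eq_zero hX hA2
  set v : ℕ → ℝ := fun k => ∫ ω, stayInd z m A k ω * ‖z k ω - m‖ ^ 2 ∂P with hvdef
  have hvi : ∀ k, Integrable (fun ω => stayInd z m A k ω * ‖z k ω - m‖ ^ 2) P :=
    h.integrable_stayInd_mul_sq A
  have hvB : ∀ k, v k ≤ A ^ 2 := fun k => by
    have := integral_mono (hvi k) (integrable_const (A ^ 2)) (stayInd_mul_sq_le A k)
    simpa using this
  obtain ⟨K, hK, hvK⟩ := exists_le_rpow_of_recursion hvB (by positivity) hb hc hα0 hα1 fun k => by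
    obtain ⟨hi, hle⟩ := h.integral_stayInd_mul_succ_le (k := k) hX hA.le
      (by positivity) hcoer
    exact (integral_mono (hvi (k + 1)) hi (stayInd_succ_mul_le A k)).trans hle
  have hwi : ∀ k, Integrable (fun ω => stayInd z m A k ω * ‖z k ω - m‖) P :=
    h.integrable_stayInd_mul hA.le
  have hw : ∀ k : ℕ, ∫ ω, stayInd z m A k ω * ‖z k ω - m‖ ∂P ≤
      (1 + K) * ((k : ℝ) + 1) ^ (-(α / 2)) := fun k => by
    set τ := ((k : ℝ) + 1) ^ (-(α / 2)) with hτ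
    have hτ0 : 0 < τ := by positivity
    have hτ2 : ((k : ℝ) + 1) ^ (-α) = τ ^ 2 := by
      rw [hτ, ← Real.rpow_natCast, ← Real.rpow_mul (by positivity)]; congr 1; push_cast; ring
    -- The inequality `y ≤ τ + y² / τ`, with `τ` the square root of the rate of `v`, stands in for
    -- Cauchy–Schwarz.
    have h1 : ∫ ω, stayInd z m A k ω * ‖z k ω - m‖ ∂P ≤
        ∫ ω, (τ + τ⁻¹ * (stayInd z m A k ω * ‖z k ω - m‖ ^ 2)) ∂P := by
      refine integral_mono (hwi k) ((integrable_const τ).add ((hvi k).const_mul _)) fun ω => ?_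
      have h2 : stayInd z m A k ω * ‖z k ω - m‖ ^ 2 =
          (stayInd z m A k ω * ‖z k ω - m‖) ^ 2 := by rw [mul_pow, stayInd_sq]
      simp only [h2]
      set y := stayInd z m A k ω * ‖z k ω - m‖
      have h3 : τ + τ⁻¹ * y ^ 2 - y = τ⁻¹ * ((y - τ / 2) ^ 2 + 3 / 4 * τ ^ 2) := by
        field_simp; ring
      have h4 : 0 ≤ τ⁻¹ * ((y - τ / 2) ^ 2 + 3 / 4 * τ ^ 2) := by positivity
      linarith
    rw [integral_add (integrable_const τ) ((hvi k).const_mul _), integral_const_mul] at h1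
    have h2 : τ⁻¹ * v k ≤ τ⁻¹ * (K * τ ^ 2) := by
      have := hvK k; rw [hτ2] at this; gcongr
    have h3 : τ⁻¹ * (K * τ ^ 2) = K * τ := by field_simp
    simp only [integral_const, probReal_univ, smul_eq_mul, one_mul] at h1
    change _ ≤ τ + τ⁻¹ * v k at h1
    linarith
  obtain ⟨C', hC', hnoise⟩ := h.exists_integral_noiseSum_sq_le hX hA2 hA3 hm0
  have hNm : ∀ n, Measurable (noiseSum P X x z m A n) := fun n =>
    (h.measurable_noiseSum hX A n).mono (F.le n) le_rfl
  have hNi : ∀ n, Integrable (fun ω => ‖noiseSum P X x z m A n ω‖) P := fun n =>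
    Integrable.of_bound (hNm n).norm.aestronglyMeasurable (n * 3)
      (Filter.Eventually.of_forall fun ω => by rw [norm_norm]; exact norm_noiseSum_le A n ω)
  have hNi2 : ∀ n, Integrable (fun ω => ‖noiseSum P X x z m A n ω‖ ^ 2) P := fun n =>
    Integrable.of_bound ((hNm n).norm.pow_const 2).aestronglyMeasurable ((n * 3) ^ 2)
      (Filter.Eventually.of_forall fun ω => by
        rw [Real.norm_eq_abs, abs_of_nonneg (sq_nonneg _)]
        exact pow_le_pow_left₀ (norm_nonneg _) (norm_noiseSum_le A n ω) 2)
  -- Using `y ≤ 1 + y²` costs a square root, but `n ^ (1 - α)` is still `o(√n)` when `α > 1/2`.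
  have hN : ∀ n, ∫ ω, ‖noiseSum P X x z m A n ω‖ ∂P ≤
      1 + C' * ∑ k ∈ Finset.range n, v k := fun n => by
    have h1 : ∫ ω, ‖noiseSum P X x z m A n ω‖ ∂P ≤
        ∫ ω, (1 + ‖noiseSum P X x z m A n ω‖ ^ 2) ∂P :=
      integral_mono (hNi n) ((integrable_const 1).add (hNi2 n)) fun ω => by
        simp only
        nlinarith [sq_nonneg (‖noiseSum P X x z m A n ω‖ - 1)]
    rw [integral_add (integrable_const 1) (hNi2 n)] at h1
    simp only [integral_const, probReal_univ, smul_eq_mul, one_mul] at h1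
    linarith [hnoise A n]
  have hV : ∀ n : ℕ, ∑ k ∈ Finset.range n, v k ≤ K / (1 - α) * ((n : ℝ) + 1) ^ (1 - α) :=
    fun n => by
    refine (Finset.sum_le_sum fun k _ => hvK k).trans ?_
    rw [← Finset.mul_sum, div_mul_eq_mul_div, mul_div_assoc]
    refine mul_le_mul_of_nonneg_left ((sum_rpow_neg_le hα0 hα1 n).trans ?_) hK
    have : 0 ≤ 1 - α := by linarith
    gcongr
    linarith
  have hI2 : ∀ n : ℕ, Integrable (fun ω => ∑ k ∈ Finset.range n, ((γ (k + 1))⁻¹ - (γ k)⁻¹) *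
      (stayInd z m A (k + 1) ω * ‖z (k + 1) ω - m‖)) P := fun n =>
    integrable_finsetSum _ fun k _ => (hwi (k + 1)).const_mul _
  have hI3 : ∀ n : ℕ, Integrable (fun ω => ∑ k ∈ Finset.range n,
      stayInd z m A k ω * ‖z k ω - m‖ ^ 2) P := fun n =>
    integrable_finsetSum _ fun k _ => hvi k
  have hE2 : ∀ n : ℕ, ∫ ω, ∑ k ∈ Finset.range n, ((γ (k + 1))⁻¹ - (γ k)⁻¹) *
      (stayInd z m A (k + 1) ω * ‖z (k + 1) ω - m‖) ∂P ≤
      c⁻¹ * (1 + K) / (α / 2) * ((n : ℝ) + 1) ^ (α / 2) := fun n => by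
    rw [integral_finsetSum _ fun k _ => (hwi (k + 1)).const_mul _]
    have h1 : ∀ k ∈ Finset.range n, ∫ ω, ((γ (k + 1))⁻¹ - (γ k)⁻¹) *
        (stayInd z m A (k + 1) ω * ‖z (k + 1) ω - m‖) ∂P ≤
        c⁻¹ * (1 + K) * (((k + 1 : ℕ) : ℝ) + 1) ^ (-(1 - α / 2)) := fun k _ => by
      have e : ((k + 1 : ℕ) : ℝ) + 1 = (k : ℝ) + 2 := by push_cast; ring
      have hk2 : (0 : ℝ) < (k : ℝ) + 2 := by positivity
      have h2 := hw (k + 1)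
      have h3 := rpow_succ_sub_rpow_le hα1.le k
      have h4 : 0 ≤ ∫ ω, stayInd z m A (k + 1) ω * ‖z (k + 1) ω - m‖ ∂P :=
        integral_nonneg fun ω => mul_nonneg (stayInd_nonneg _ _ _) (norm_nonneg _)
      rw [integral_const_mul, hγinv, hγinv, ← mul_sub]
      rw [e] at h2 ⊢
      -- Increments of `1 / γ` of order `k ^ (α - 1)` meet mean errors of order `k ^ (-α / 2)`; the
      -- products sum to order `n ^ (α / 2)`.
      have h5 : c⁻¹ * (((k : ℝ) + 2) ^ α - ((k : ℝ) + 1) ^ α) *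
          (∫ ω, stayInd z m A (k + 1) ω * ‖z (k + 1) ω - m‖ ∂P) ≤
          c⁻¹ * ((k : ℝ) + 2) ^ (α - 1) * ((1 + K) * ((k : ℝ) + 2) ^ (-(α / 2))) := by
        gcongr
      refine h5.trans_eq ?_
      have h6 : ((k : ℝ) + 2) ^ (-(1 - α / 2)) =
          ((k : ℝ) + 2) ^ (α - 1) * ((k : ℝ) + 2) ^ (-(α / 2)) := by
        rw [← Real.rpow_add hk2]; congr 1; ring
      rw [h6]; ring
    refine (Finset.sum_le_sum h1).trans ?_
    rw [← Finset.mul_sum, div_mul_eq_mul_div, mul_div_assoc]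
    refine mul_le_mul_of_nonneg_left ?_ (by positivity)
    have h2 := sum_rpow_neg_le (s := 1 - α / 2) (by linarith) (by linarith) (n + 1)
    rw [Finset.sum_range_succ', sub_sub_cancel] at h2
    push_cast at h2 ⊢
    refine le_trans (le_add_of_nonneg_right (by positivity)) h2
  refine ⟨(γ 0)⁻¹ * A + c⁻¹ * (1 + K) + c⁻¹ * (1 + K) / (α / 2) + 1 + C' * (K / (1 - α)) +
    C * (K / (1 - α)), ?_, fun n => ⟨?_, ?_⟩⟩
  · have : 0 < 1 - α := by linarith
    rw [hγinv]
    positivity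
  · exact ((((integrable_const _).add ((hwi n).const_mul _)).add (hI2 n)).add (hNi n)).add
      ((hI3 n).const_mul C)
  · have hE1 : (γ n)⁻¹ * ∫ ω, stayInd z m A n ω * ‖z n ω - m‖ ∂P ≤
        c⁻¹ * (1 + K) * ((n : ℝ) + 1) ^ (α / 2) := by
      have h6 : ((n : ℝ) + 1) ^ (α / 2) = ((n : ℝ) + 1) ^ α * ((n : ℝ) + 1) ^ (-(α / 2)) := by
        rw [← Real.rpow_add (by positivity)]; congr 1; ring
      rw [hγinv, h6]
      have := mul_le_mul_of_nonneg_left (hw n)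
        (by positivity : 0 ≤ c⁻¹ * ((n : ℝ) + 1) ^ α)
      linarith
    have hsplit : ∫ ω, remainder P X γ x z m A C n ω ∂P = (γ 0)⁻¹ * A +
        (γ n)⁻¹ * ∫ ω, stayInd z m A n ω * ‖z n ω - m‖ ∂P +
        ∫ ω, ∑ k ∈ Finset.range n, ((γ (k + 1))⁻¹ - (γ k)⁻¹) *
          (stayInd z m A (k + 1) ω * ‖z (k + 1) ω - m‖) ∂P +
        ∫ ω, ‖noiseSum P X x z m A n ω‖ ∂P + C * ∑ k ∈ Finset.range n, v k := by
      unfold remainder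
      rw [integral_add ((((integrable_const _).fun_add ((hwi n).const_mul _)).fun_add
          (hI2 n)).fun_add (hNi n)) ((hI3 n).const_mul C),
        integral_add (((integrable_const _).fun_add ((hwi n).const_mul _)).fun_add (hI2 n)) (hNi n),
        integral_add ((integrable_const _).fun_add ((hwi n).const_mul _)) (hI2 n),
        integral_add (integrable_const _) ((hwi n).const_mul _), integral_const_mul,
        integral_const_mul, integral_const_mul, integral_finsetSum _ fun k _ => hvi k]
      simp [hvdef]
    rw [hsplit]
    have hp1 : 1 ≤ ((n : ℝ) + 1) ^ (α / 2) :=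
      Real.one_le_rpow (by linarith [n.cast_nonneg (α := ℝ)]) (by positivity)
    have hp2 : 0 < ((n : ℝ) + 1) ^ (1 - α) := by positivity
    set p := ((n : ℝ) + 1) ^ (α / 2)
    set q := ((n : ℝ) + 1) ^ (1 - α)
    have hg0 : 0 ≤ (γ 0)⁻¹ * A := by rw [hγinv]; positivity
    have hα : 0 < 1 - α := by linarith
    have t1 : (γ 0)⁻¹ * A ≤ (γ 0)⁻¹ * A * (p + q) :=
      le_mul_of_one_le_right hg0 (by linarith)
    have t2 : c⁻¹ * (1 + K) * p ≤ c⁻¹ * (1 + K) * (p + q) := by gcongr; linarith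
    have t3 : c⁻¹ * (1 + K) / (α / 2) * p ≤ c⁻¹ * (1 + K) / (α / 2) * (p + q) := by
      gcongr; linarith
    have t4 : C' * ∑ k ∈ Finset.range n, v k ≤ C' * (K / (1 - α)) * (p + q) := by
      rw [mul_assoc]
      refine mul_le_mul_of_nonneg_left ((hV n).trans ?_) hC'
      gcongr; linarith
    have t5 : C * ∑ k ∈ Finset.range n, v k ≤ C * (K / (1 - α)) * (p + q) := by
      rw [mul_assoc]
      refine mul_le_mul_of_nonneg_left ((hV n).trans ?_) hC
      gcongr; linarith
    linarith [hN n, hE2 n]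

end IsMedianSGD

end Assembly

/-! ### Choice of constants, and passage to the given sample. -/

section Confidence

variable {H : Type*} [NormedAddCommGroup H] [InnerProductSpace ℝ H] [MeasurableSpace H]
  {Ω : Type*} {mΩ : MeasurableSpace Ω} [BorelSpace H] [SecondCountableTopology H]
  {P : Measure Ω} [IsProbabilityMeasure P] {X : Ω → H} {F : Filtration ℕ mΩ}
  {x z : ℕ → Ω → H} {m : H}

lemma eventually_mul_rpow_add_rpow_le {a b D ε : ℝ} (ha : a < 1 / 2) (hb : b < 1 / 2)
    (hε : 0 < ε) :
    ∀ᶠ n : ℕ in Filter.atTop, D * (((n : ℝ) + 1) ^ a + ((n : ℝ) + 1) ^ b) ≤ ε * √n := by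
  have htop : Filter.Tendsto (fun k : ℕ => (k : ℝ) + 1) Filter.atTop Filter.atTop :=
    Filter.tendsto_atTop_add_const_right _ _ tendsto_natCast_atTop_atTop
  have h1 := (tendsto_rpow_neg_atTop (y := 1 / 2 - a) (by linarith)).comp htop
  have h2 := (tendsto_rpow_neg_atTop (y := 1 / 2 - b) (by linarith)).comp htop
  have h3 := (h1.add h2).const_mul D
  rw [add_zero, mul_zero] at h3
  filter_upwards [h3.eventually_le_const (u := ε / 2) (by positivity),
    Filter.eventually_ge_atTop 1] with n hn hn1
  have hn0 : (0 : ℝ) < (n : ℝ) + 1 := by positivity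
  have hn1' : (1 : ℝ) ≤ n := by exact_mod_cast hn1
  have e : ∀ s : ℝ, ((n : ℝ) + 1) ^ s = ((n : ℝ) + 1) ^ (-(1 / 2 - s)) * √((n : ℝ) + 1) :=
    fun s => by
      rw [Real.sqrt_eq_rpow, ← Real.rpow_add hn0]; congr 1; ring
  have h4 : √((n : ℝ) + 1) ≤ 2 * √n := by
    rw [Real.sqrt_le_left (by positivity), mul_pow, Real.sq_sqrt (by positivity)]
    linarith
  simp only [Function.comp_apply] at hn
  rw [e a, e b, ← add_mul, ← mul_assoc]
  calc _ ≤ ε / 2 * √((n : ℝ) + 1) := by gcongr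
    _ ≤ ε / 2 * (2 * √n) := by gcongr
    _ = _ := by ring

lemma sum_range_sq_rpow_neg_bounded {c α : ℝ} (hα : 1 / 2 < α) :
    ∃ G : ℝ, 0 ≤ G ∧ ∀ n : ℕ, ∑ k ∈ Finset.range n, (c * ((k : ℝ) + 1) ^ (-α)) ^ 2 ≤ G := by
  have hs : Summable fun k : ℕ => (c * ((k : ℝ) + 1) ^ (-α)) ^ 2 := by
    have h1 : Summable fun k : ℕ => ((k : ℝ)) ^ (-(2 * α)) :=
      Real.summable_nat_rpow.2 (by linarith)
    have h2 := ((summable_nat_add_iff 1).2 h1).mul_left (c ^ 2)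
    refine h2.congr fun k => ?_
    rw [mul_pow, ← Real.rpow_natCast (((k : ℝ) + 1) ^ (-α)), ← Real.rpow_mul (by positivity)]
    push_cast
    congr 2; ring
  exact ⟨_, tsum_nonneg fun k => sq_nonneg _, fun n =>
    hs.sum_le_tsum _ fun k _ => sq_nonneg _⟩

/-- As `L = log (4 / δ)` exceeds 1, `(3 L)² / 2 ≥ L`, and `2 exp (-L) = δ / 2`. -/
lemma two_mul_exp_neg_sq_le {δ : ℝ} (hδ : δ ∈ Set.Ioo (0 : ℝ) 1) :
    1 < Real.log (4 / δ) ∧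
      2 * Real.exp (-((3 * Real.log (4 / δ)) ^ 2 / 2)) ≤ δ / 2 := by
  obtain ⟨h0, h1⟩ := hδ
  have h4 : 4 < 4 / δ := by rw [lt_div_iff₀ h0]; linarith
  have hL : 1 < Real.log (4 / δ) := by
    rw [Real.lt_log_iff_exp_lt (by positivity)]
    linarith [Real.exp_one_lt_d9]
  refine ⟨hL, ?_⟩
  have h2 : Real.exp (-((3 * Real.log (4 / δ)) ^ 2 / 2)) ≤ Real.exp (-Real.log (4 / δ)) := by
    rw [Real.exp_le_exp]; nlinarith
  rw [Real.exp_neg (Real.log _), Real.exp_log (by positivity), inv_div] at h2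
  linarith

namespace IsMedianSGD

lemma measureReal_stay_compl (h : IsMedianSGD P X γ F x z) (A : ℝ) (n : ℕ) :
    P.real (stay z m A n)ᶜ = ∫ ω, (1 - stayInd z m A n ω) ∂P := by
  have hms : MeasurableSet (stay z m A n) := F.le n _ (h.measurableSet_stay A n)
  rw [probReal_compl_eq_one_sub hms,
    integral_sub (integrable_const 1) (h.integrable_stayInd A n), stayInd,
    integral_indicator_one hms]
  simp

/-- Confidence balls for the linearized averaged algorithm. -/
lemma exists_le_measureReal_hessian_sum [CompleteSpace H] {c α : ℝ}
    (h : IsMedianSGD P X (fun k => c * ((k : ℝ) + 1) ^ (-α)) F x z) (hX : Measurable X)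
    (hA1 : NotConcentratedOnLine P X) (hA2 : BoundedInverseMoment P X 1)
    (hA3 : BoundedInverseMoment P X 2) (hm : IsGeometricMedian P X m)
    (hc : 0 < c) (hα : α ∈ Set.Ioo (1 / 2 : ℝ) 1) (hz : ∃ B : ℝ, ∀ᵐ ω ∂P, ‖z 0 ω‖ ≤ B)
    {δ : ℝ} (hδ : δ ∈ Set.Ioo (0 : ℝ) 1) :
    ∃ N : ℕ, ∀ n ≥ N, 1 - δ ≤ P.real {ω |
      ‖medianHessian P X m (∑ k ∈ Finset.range n, (z k ω - m))‖ ≤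
        4 * √n * Real.log (4 / δ)} := by
  obtain ⟨hα0, hα1⟩ := hα
  have hαpos : 0 < α := by linarith
  have hδ0 : 0 < δ := hδ.1
  set γ : ℕ → ℝ := fun k => c * ((k : ℝ) + 1) ^ (-α) with hγdef
  have hγ : ∀ k, 0 < γ k := fun k => by positivity
  have hγ' : Antitone γ := fun i j hij => by
    have h1 : (i : ℝ) + 1 ≤ j + 1 := by exact_mod_cast Nat.succ_le_succ hij
    exact mul_le_mul_of_nonneg_left
      (Real.rpow_le_rpow_of_nonpos (by positivity) h1 (by linarith)) hc.le
  have hm0 := hm.medianGradient_eq_zero hX hA2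
  have hne : ∀ᵐ ω ∂P, X ω ≠ m := by
    obtain ⟨_, _, hinv⟩ := hA2.integrable hX one_ne_zero
    exact (hinv m).1
  obtain ⟨C, hC, hL⟩ := norm_medianGradient_sub_le (P := P) hX hA2 hA3 m
  simp only [hm0, sub_zero] at hL
  obtain ⟨B, hB⟩ := hz
  set R := max (B + ‖m‖) 0 with hR
  have hR0 : 0 ≤ R := le_max_right _ _
  have hzR : ∀ᵐ ω ∂P, ‖z 0 ω - m‖ ≤ R := by
    filter_upwards [hB] with ω hω
    exact le_max_of_le_left ((norm_sub_le _ _).trans (by linarith))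
  obtain ⟨G, hG, hsum⟩ := sum_range_sq_rpow_neg_bounded (c := c) hα0
  -- Since `A ≥ 1`, `A² ≥ A ≥ 4 (R² + G) / δ`, so the exit probability is at most `δ / 4`.
  set A := R + 1 + 4 * (R ^ 2 + G) / δ with hAdef
  have hV0 : 0 ≤ 4 * (R ^ 2 + G) / δ := by positivity
  have hA : 1 ≤ A := by linarith
  have hAR : R ≤ A := by linarith
  obtain ⟨b, hb, hcoer⟩ := exists_le_inner_medianGradient hX hA1 hA2 hm (zero_lt_one.trans_le hA)
  have hexit : ∀ n, P.real (stay z m A n)ᶜ ≤ δ / 4 := fun n => by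
    have h1 := h.sq_mul_integral_exit_le hX (by linarith) hAR (fun k => (hγ k).le)
      (fun y hy => (by positivity : 0 ≤ b * ‖y - m‖ ^ 2).trans (hcoer y hy)) hzR n
    rw [← h.measureReal_stay_compl] at h1
    have h2 : R ^ 2 + G ≤ A ^ 2 * (δ / 4) := by
      have h3 : 4 * (R ^ 2 + G) / δ ≤ A ^ 2 := by nlinarith
      rw [div_le_iff₀ hδ0] at h3
      linarith
    exact le_of_mul_le_mul_left ((h1.trans (by linarith [hsum n])).trans h2) (by positivity)
  obtain ⟨D, hD, hrem⟩ := h.exists_integral_remainder_le hX hA1 hA2 hA3 hm hc hαpos hα1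
    (zero_lt_one.trans_le hA) hC
  obtain ⟨hL1, hexp⟩ := two_mul_exp_neg_sq_le hδ
  set L := Real.log (4 / δ)
  -- With this `ε`, Markov's inequality at level `L √n` leaves probability `δ / 4` for the
  -- remainder.
  obtain ⟨N, hN⟩ := Filter.eventually_atTop.1 ((eventually_mul_rpow_add_rpow_le (a := α / 2)
    (b := 1 - α) (D := D) (ε := δ / 4 * L) (by linarith) (by linarith) (by positivity)).and
      (Filter.eventually_ge_atTop 1))
  refine ⟨N, fun n hn => ?_⟩
  obtain ⟨hn1, hn2⟩ := hN n hn
  have hn0 : n ≠ 0 := by omega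
  have hsn : 0 < √(n : ℝ) := Real.sqrt_pos.2 (by positivity)
  obtain ⟨hri, hrle⟩ := hrem n
  have hrnn : ∀ ω, 0 ≤ remainder P X γ x z m A C n ω := fun ω => by
    have h1 : ∀ k, 0 ≤ (γ (k + 1))⁻¹ - (γ k)⁻¹ := fun k =>
      sub_nonneg.2 (inv_anti₀ (hγ _) (hγ' k.le_succ))
    have h2 : ∀ k, 0 ≤ stayInd z m A k ω := fun k => stayInd_nonneg _ _ _
    have h3 : 0 ≤ (γ n)⁻¹ * (stayInd z m A n ω * ‖z n ω - m‖) :=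
      mul_nonneg (inv_pos.2 (hγ n)).le (mul_nonneg (h2 n) (norm_nonneg _))
    have h4 : 0 ≤ (γ 0)⁻¹ * A := mul_nonneg (inv_pos.2 (hγ 0)).le (by linarith)
    have h5 : 0 ≤ ∑ k ∈ Finset.range n, ((γ (k + 1))⁻¹ - (γ k)⁻¹) *
        (stayInd z m A (k + 1) ω * ‖z (k + 1) ω - m‖) := Finset.sum_nonneg fun k _ =>
      mul_nonneg (h1 k) (mul_nonneg (h2 _) (norm_nonneg _))
    have h6 : 0 ≤ C * ∑ k ∈ Finset.range n, stayInd z m A k ω * ‖z k ω - m‖ ^ 2 :=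
      mul_nonneg hC (Finset.sum_nonneg fun k _ => mul_nonneg (h2 k) (sq_nonneg _))
    have h7 := norm_nonneg (noiseSum P X x z m A n ω)
    rw [remainder]
    linarith
  have hB2 : P.real {ω | L * √n ≤ remainder P X γ x z m A C n ω} ≤ δ / 4 := by
    have h1 := mul_meas_ge_le_integral_of_nonneg (Filter.Eventually.of_forall hrnn) hri (L * √n)
    refine le_of_mul_le_mul_left ?_ (by positivity : 0 < L * √n)
    linarith
  have hB1 := (h.measureReal_norm_sum_ge_le hX hne hm0 (y := 3 * L) (by positivity) hn0).trans hexp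
  set E1 := {ω | 3 * L * √n ≤ ‖∑ k ∈ Finset.range n, dir (x k ω - m)‖}
  set E2 := {ω | L * √n ≤ remainder P X γ x z m A C n ω}
  set T := {ω | ‖medianHessian P X m (∑ k ∈ Finset.range n, (z k ω - m))‖ ≤ 4 * √n * L}
  -- The threshold splits as `3 L √n + L √n`, and the failure probability as `δ/2 + δ/4 + δ/4`.
  have hcover : (Set.univ : Set Ω) ⊆ T ∪ (E1 ∪ E2 ∪ (stay z m A n)ᶜ) := by
    intro ω _
    by_cases h1 : ω ∈ E1
    · exact Or.inr (Or.inl (Or.inl h1))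
    by_cases h2 : ω ∈ E2
    · exact Or.inr (Or.inl (Or.inr h2))
    by_cases h3 : ω ∈ stay z m A n
    · left
      have h4 := h.norm_hessian_sum_le hγ hγ' hL h3
      simp only [E1, E2, Set.mem_ofPred_eq, not_le] at h1 h2
      simp only [T, Set.mem_ofPred_eq]
      linarith
    · exact Or.inr (Or.inr h3)
  have h1 := measureReal_mono (μ := P) hcover
  rw [probReal_univ] at h1
  have h2 := measureReal_union_le (μ := P) T (E1 ∪ E2 ∪ (stay z m A n)ᶜ)
  have h3 := measureReal_union_le (μ := P) (E1 ∪ E2) (stay z m A n)ᶜ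
  have h4 := measureReal_union_le (μ := P) E1 E2
  linarith [hexit n]

end IsMedianSGD

/-- The filtration generated by a random variable and a sequence of random variables. -/
def sampleFiltration (Z₁ : Ω → H) (hZ₁ : Measurable Z₁) (x : ℕ → Ω → H)
    (hx : ∀ k, Measurable (x k)) : Filtration ℕ mΩ where
  seq k := MeasurableSpace.comap (fun ω => (Z₁ ω, fun i : Finset.range k => x i ω)) inferInstance
  mono' i j hij := by
    rw [← measurable_iff_comap_le]
    have hj := comap_measurable (m := Prod.instMeasurableSpace) fun ω => (Z₁ ω, fun i : Finset.range j => x i ω)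
    have hφ : Measurable fun p : H × (Finset.range j → H) => (p.1, fun a : Finset.range i =>
        p.2 ⟨a, Finset.mem_range.2 ((Finset.mem_range.1 a.2).trans_le hij)⟩) :=
      measurable_fst.prodMk (measurable_pi_lambda _ fun _ =>
        (measurable_pi_apply _).comp measurable_snd)
    exact hφ.comp hj
  le' k := (hZ₁.prodMk (measurable_pi_lambda _ fun _ => hx _)).comap_le

/-- The joint law of `Z₁`, the earlier observations and `x k` is a triple product; reassociating it
separates `x k` from the other two. -/
lemma indep_sampleFiltration {Z₁ : Ω → H} (hZ₁ : Measurable Z₁) {x : ℕ → Ω → H}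
    (hx : ∀ k, Measurable (x k)) (hindep : iIndepFun x P)
    (hZx : IndepFun Z₁ (fun ω k => x k ω) P) (k : ℕ) :
    Indep (sampleFiltration Z₁ hZ₁ x hx k) (MeasurableSpace.comap (x k) inferInstance) P := by
  set W : Ω → (Finset.range k → H) := fun ω i => x i ω
  have hW : Measurable W := measurable_pi_lambda _ fun _ => hx _
  change Indep (MeasurableSpace.comap (fun ω => (Z₁ ω, W ω)) inferInstance) _ P
  rw [← IndepFun_iff_Indep]
  have h1 : IndepFun W (x k) P := by
    have := hindep.indepFun_finset (Finset.range k) {k} (by simp) hx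
    exact this.comp measurable_id (measurable_pi_apply (⟨k, by simp⟩ : ({k} : Finset ℕ)))
  have hproj : Measurable fun f : ℕ → H => ((fun i : Finset.range k => f i), f k) :=
    (measurable_pi_lambda _ fun _ => measurable_pi_apply _).prodMk (measurable_pi_apply k)
  have h2 : IndepFun Z₁ (fun ω => (W ω, x k ω)) P := hZx.comp measurable_id hproj
  have h3 : IndepFun Z₁ W P := h2.comp measurable_id measurable_fst
  rw [indepFun_iff_map_prod_eq_prod_map_map (hZ₁.prodMk hW).aemeasurable (hx k).aemeasurable,
    h3.map_prod_eq_prod_map_map hZ₁.aemeasurable hW.aemeasurable]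
  have e1 := h2.map_prod_eq_prod_map_map hZ₁.aemeasurable (hW.prodMk (hx k)).aemeasurable
  rw [h1.map_prod_eq_prod_map_map hW.aemeasurable (hx k).aemeasurable,
    ← Measure.prodAssoc_prod] at e1
  have e2 := congrArg (Measure.map MeasurableEquiv.prodAssoc.symm) e1
  rw [Measure.map_map (MeasurableEquiv.measurable _) (MeasurableEquiv.measurable _),
    Measure.map_map (MeasurableEquiv.measurable _) (hZ₁.prodMk (hW.prodMk (hx k))),
    MeasurableEquiv.symm_comp_self, Measure.map_id] at e2
  exact e2

/-- Index shift: time 0 is `Z_1`, and step `k` uses the observation `X_{k+2}` and the step size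
`γ_{k+1}`. -/
lemma isMedianSGD_medianSGD {Xs : ℕ → Ω → H} (hXs : ∀ k, Measurable (Xs (k + 1)))
    (hindep : iIndepFun (fun k => Xs (k + 1)) P)
    (hident : ∀ k, IdentDistrib (Xs (k + 1)) X P P) {Z₁ : Ω → H} (hZ₁ : Measurable Z₁)
    (hZ₁indep : IndepFun Z₁ (fun ω k => Xs (k + 2) ω) P) (γ : ℕ → ℝ) :
    IsMedianSGD P X (fun k => γ (k + 1))
      (sampleFiltration Z₁ hZ₁ (fun k => Xs (k + 2)) fun k => hXs (k + 1))
      (fun k => Xs (k + 2)) (fun k => medianSGD γ Xs Z₁ (k + 1)) where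
  measurable_sample k := by
    have hj := comap_measurable (m := Prod.instMeasurableSpace) fun ω => (Z₁ ω, fun i : Finset.range (k + 1) => Xs (i + 2) ω)
    exact (measurable_pi_apply (⟨k, by simp⟩ : Finset.range (k + 1))).comp (measurable_snd.comp hj)
  indep_sample k := indep_sampleFiltration hZ₁ _
    (hindep.precomp (g := fun k => k + 1) (add_left_injective 1)) hZ₁indep k
  ident_sample k := hident (k + 1)
  measurable_zero := by
    have hj := comap_measurable (m := Prod.instMeasurableSpace) fun ω => (Z₁ ω, fun i : Finset.range 0 => Xs (i + 2) ω)
    exact measurable_fst.comp hj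
  step k ω := rfl

lemma averagedSGD_sub {γ : ℕ → ℝ} {Xs : ℕ → Ω → H} {Z₁ : Ω → H} {n : ℕ} (hn : n ≠ 0) (ω : Ω) :
    averagedSGD γ Xs Z₁ n ω - m =
      (n : ℝ)⁻¹ • ∑ k ∈ Finset.range n, (medianSGD γ Xs Z₁ (k + 1) ω - m) := by
  have h1 : ∑ k ∈ Finset.Icc 1 n, medianSGD γ Xs Z₁ k ω =
      ∑ k ∈ Finset.range n, medianSGD γ Xs Z₁ (k + 1) ω := by
    rw [Finset.range_eq_Ico, Finset.sum_Ico_add' (fun k => medianSGD γ Xs Z₁ k ω)]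
    rfl
  have hn' : (n : ℝ) ≠ 0 := Nat.cast_ne_zero.2 hn
  rw [averagedSGD, h1, Finset.sum_sub_distrib, smul_sub, Finset.sum_const, Finset.card_range,
    ← Nat.cast_smul_eq_nsmul ℝ, inv_smul_smul₀ hn']

end Confidence

/-! ### The main theorem. -/

theorem theorem4p2
    {H : Type*} [NormedAddCommGroup H] [InnerProductSpace ℝ H] [CompleteSpace H]
    [TopologicalSpace.SeparableSpace H] [MeasurableSpace H] [BorelSpace H]
    {Ω : Type*} [MeasurableSpace Ω] (P : Measure Ω) [IsProbabilityMeasure P]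
    -- the random variable and its median
    (X : Ω → H) (hX : Measurable X) (m : H) (hm : IsGeometricMedian P X m)
    -- the three assumptions on the law of `X`
    (hA1 : NotConcentratedOnLine P X)
    (hA2 : BoundedInverseMoment P X 1)
    (hA3 : BoundedInverseMoment P X 2)
    -- `X_1, X_2, …` are i.i.d. copies of `X`
    (Xs : ℕ → Ω → H) (hXs : ∀ k, Measurable (Xs (k + 1)))
    (hindep : iIndepFun (fun k => Xs (k + 1)) P)
    (hident : ∀ k, IdentDistrib (Xs (k + 1)) X P P)
    -- the starting point is bounded and independent of `X_2, X_3, …`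
    (Z₁ : Ω → H) (hZ₁ : Measurable Z₁) (hZ₁bdd : ∃ B : ℝ, ∀ᵐ ω ∂P, ‖Z₁ ω‖ ≤ B)
    (hZ₁indep : IndepFun Z₁ (fun ω k => Xs (k + 2) ω) P)
    -- the step sizes are `γ_n = c n^{-α}`
    (c α : ℝ) (hc : 0 < c) (hα : α ∈ Set.Ioo (1 / 2 : ℝ) 1) :
    HasFDerivAt (gradient (medianObjective P X)) (medianHessian P X m) m ∧
    ∃ lmin : ℝ,
      IsLeast {l : ℝ | Module.End.HasEigenvalue (medianHessian P X m : H →ₗ[ℝ] H) l} lmin ∧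
      0 < lmin ∧
      ∀ δ ∈ Set.Ioo (0 : ℝ) 1, ∃ N : ℕ, ∀ n ≥ N,
        1 - δ ≤ P.real {ω |
            ‖medianHessian P X m (averagedSGD (stepSize c α) Xs Z₁ n ω - m)‖ ≤
              4 * (2 / (3 * (n : ℝ)) + 1 / √(n : ℝ)) * Real.log (4 / δ)} ∧
        1 - δ ≤ P.real {ω |
            ‖averagedSGD (stepSize c α) Xs Z₁ n ω - m‖ ≤
              4 / lmin * (2 / (3 * (n : ℝ)) + 1 / √(n : ℝ)) * Real.log (4 / δ)} := by
  have : SecondCountableTopology H := UniformSpace.secondCountable_of_separable H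
  obtain ⟨C, -, hL⟩ := norm_medianGradient_sub_le (P := P) hX hA2 hA3 m
  refine ⟨?_, ?_⟩
  · rw [gradient_medianObjective hX hA2]
    exact hasFDerivAt_of_norm_sub_le_sq hL
  obtain ⟨l, hl, heig, hle⟩ := exists_hasEigenvalue_medianHessian hX hA1 hA2 m
  refine ⟨l, ⟨heig, fun l' hl' => ?_⟩, hl, fun δ hδ => ?_⟩
  · obtain ⟨v, hv⟩ := Module.End.HasEigenvalue.exists_hasEigenvector hl'
    have h1 : medianHessian P X m v = l' • v := hv.apply_eq_smul
    have h2 := hle v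
    rw [h1, real_inner_smul_right, real_inner_self_eq_norm_sq] at h2
    exact le_of_mul_le_mul_right h2 (pow_pos (norm_pos_iff.2 hv.2) 2)
  have hsgd := isMedianSGD_medianSGD hXs hindep hident hZ₁ hZ₁indep (stepSize c α)
  simp only [stepSize, Nat.cast_add, Nat.cast_one] at hsgd
  obtain ⟨N, hN⟩ := hsgd.exists_le_measureReal_hessian_sum hX hA1 hA2 hA3 hm hc hα hZ₁bdd hδ
  refine ⟨max N 1, fun n hn => ?_⟩
  have hn0 : n ≠ 0 := by have := (le_max_right N 1).trans hn; omega
  have hnpos : (0 : ℝ) < n := by positivity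
  have hlog : 0 < Real.log (4 / δ) := zero_lt_one.trans (two_mul_exp_neg_sq_le hδ).1
  have key : 1 - δ ≤ P.real {ω |
      ‖medianHessian P X m (averagedSGD (stepSize c α) Xs Z₁ n ω - m)‖ ≤
        4 * (2 / (3 * (n : ℝ)) + 1 / √(n : ℝ)) * Real.log (4 / δ)} := by
    refine (hN n ((le_max_left N 1).trans hn)).trans (measureReal_mono fun ω hω => ?_)
    simp only [Set.mem_ofPred_eq] at hω ⊢
    rw [averagedSGD_sub hn0, map_smul, norm_smul, norm_inv, Real.norm_natCast,
      inv_mul_le_iff₀ hnpos]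
    refine LE.le.trans (b := 4 * √(n : ℝ) * Real.log (4 / δ)) hω ?_
    -- The term `1 / √n` already accounts for the whole bound; `2 / (3 n)` is only slack.
    have hs : (n : ℝ) * (1 / √(n : ℝ)) = √(n : ℝ) := by
      rw [mul_one_div, Real.div_sqrt]
    have h2 : (n : ℝ) * (4 * (2 / (3 * (n : ℝ)) + 1 / √(n : ℝ)) * Real.log (4 / δ)) =
        4 * (n * (1 / √(n : ℝ))) * Real.log (4 / δ) +
          n * (4 * (2 / (3 * n)) * Real.log (4 / δ)) := by ring
    rw [h2, hs]
    exact le_add_of_nonneg_right (by positivity)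
  refine ⟨key, key.trans (measureReal_mono fun ω hω => ?_)⟩
  simp only [Set.mem_ofPred_eq] at hω ⊢
  set T := averagedSGD (stepSize c α) Xs Z₁ n ω - m
  -- Coercivity and Cauchy–Schwarz: the second event contains the first.
  have h1 : l * ‖T‖ ≤ ‖medianHessian P X m T‖ := by
    by_cases hT : T = 0
    · simp [hT]
    · have h2 := (hle T).trans (real_inner_le_norm _ _)
      have h3 := norm_pos_iff.2 hT
      nlinarith
  rw [div_mul_eq_mul_div, div_mul_eq_mul_div, le_div_iff₀ hl, mul_comm]
  exact h1.trans hω
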